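/- **Theorem 3.2 (Main theorem on non-linear systems of PDEs).** Let $\mathbb K=\mathbb R$ or $\mathbb C$, let $n,r,s$ be natural numbers and $\mathbf m=(m_1,\dots,m_r)\in\mathbb N^r$. *Spaces.* Let $\mathbb A_n^k$ be the space of $k$-tuples of germs at $0\in\mathbb K^n$ of analytic functions, identified with their (convergent) Taylor series, and let $\mathcal F^{>0}_{r,\mathbf m}\subset\mathbb A_n^r$ be the subspace of those $F=(F_1,\dots,F_r)$ such that $F_j$ has zero $m_j$-jet at $0$ for every $j$. Let $\widehat{\mathcal F}^{>0}_{r,\mathbf m}$ be the corresponding space of $r$-tuples of formal power series. *Orders.* For $G\in\mathbb A_n^s$ let $\operatorname{ord}_0 G$ be the lowest degree in which a component of $G$ has a nonzero homogeneous part. For $F\in\mathcal F^{>0}_{r,\mathbf m}$ let $\operatorname{ord}_0F=\min_j(\operatorname{ord}_0F_j-m_j)$. The order of $0$ is $+\infty$. A map $\mathcal T:\mathcal F^{>0}_{r,\mathbf m}\to\mathbb A_n^s$ *increases the order by $q$* (resp. *strictly*) if $\operatorname{ord}_0(\mathcal T(F)-\mathcal T(G))\ge\operatorname{ord}_0(F-G)+q$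 for all $F,G$ (resp. $>$ instead of $\geq$ whenever the right-hand side is finite). *Differential maps.* For $F\in\widehat{\mathcal F}^{>0}_{r,\mathbf m}$ put $\partial F=\left(\partial^{|\alpha|}F_j/\partial x^\alpha:\ 1\le j\le r,\ |\alpha|\le m_j\right)$. The map $\mathcal T$ is a *regular analytic differential map of order $\mathbf m$* (with respect to $q$) if there is an analytic map germ $W=(W_1,\dots,W_s)$ at the origin, in the variables $(x_1,\dots,x_n,u_{j,\alpha})$, $1\le j\le r$, $|\alpha|\le m_j$, with values in $\mathbb K^s$, such that $W(0)=0$, $\mathcal T(F)(x)=W(x,\partial F(x))$ for all $F\in\mathcal F^{>0}_{r,\mathbf m}$, and $$\operatorname{ord}_0\left(\frac{\partial W_i}{\partial u_{j,\alpha}}(x,\partial F)\right)\ \ge\ \max(0,\,|\alpha|+q+1-m_j)$$ for all $i,j,\alpha$ and all formal $F\in\widehat{\mathcal F}^{>0}_{r,\mathbf m}$. *Majorants.* For $F\in\mathbb A_n^k$ with homogeneous parts $F^{(i)}$ let $\widehat F(z)=\sum_{i\ge0}\|F^{(i)}\|z^i$, where the norm of a homogeneous polynomial is the sum of the absolute values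 of its coefficients and the norm of a tuple is the maximum of the norms of its components. For one-variable series, $f\prec g$ means that $|f_p|\le g_p$ for every $p$. *Hypothesis (big denominators property of order $\mathbf m$).* Let $\mathcal S:\mathcal F^{>0}_{r,\mathbf m}\to\mathbb A_n^s$ be linear, let $\pi:\mathbb A_n^s\to\operatorname{Im}\mathcal S$ be linear, and let $\mathcal T:\mathcal F^{>0}_{r,\mathbf m}\to\mathbb A_n^s$ be a map. Assume that there is an integer $q\ge0$ such that 1. $\mathcal T$ is a regular analytic differential map of order $\mathbf m$ that strictly increases the order by $q$, and the $q$-jet of $\mathcal T(0)$ at $0$ vanishes; 2. $\mathcal S$ increases the order by $q$; 3. $\pi$ is a projection, that is, $\pi(y)=y$ for all $y\in\operatorname{Im}\mathcal S$; 4. $\mathcal S$ has a right inverse $\mathcal S^{-1}:\operatorname{Im}\mathcal S\to\mathcal F^{>0}_{r,\mathbf m}$ and there is $C>0$ such that for all $G\in\mathbb A_n^s$ of order $\ge q+1$ and all $1\le i\le r$ $$\frac{d^{m_i}}{dz^{m_i}}\left(z^q\,\widehat{\mathcal S_i^{-1}(\pi G)}\right)\ \prec\ C\,\widehat G,$$ where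 $\mathcal S_i^{-1}$ is the $i$-th component of $\mathcal S^{-1}$. *Conclusion.* The equation $\mathcal S(F)=\pi(\mathcal T(F))$ has an analytic solution $F\in\mathcal F^{>0}_{r,\mathbf m}$. -/

import Mathlib

noncomputable section

namespace BigDenom

open MvPowerSeries

/-! ### Convergent power series: germs of analytic functions -/

/-- A power series in finitely many variables over `ℝ` or `ℂ` is convergent (it is the Taylor
series at the origin of a germ of an analytic function) if its coefficients grow at most
geometrically in the degree. -/
def IsConvergent {𝕜 : Type*} [RCLike 𝕜] {σ : Type*} (f : MvPowerSeries σ 𝕜) : Prop :=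
  ∃ M R : ℝ, 0 < M ∧ 0 < R ∧ ∀ α : σ →₀ ℕ, ‖coeff α f‖ ≤ M * R ^ α.degree

/-- `𝔸_n^k`: the space of `k`-tuples of germs at `0 ∈ 𝕜ⁿ` of analytic functions, each germ being
given by its (convergent) Taylor series. -/
def AnalyticGerms (𝕜 : Type*) [RCLike 𝕜] (n k : ℕ) :
    Submodule 𝕜 (Fin k → MvPowerSeries (Fin n) 𝕜) where
  carrier := {F | ∀ j, IsConvergent (F j)}
  zero_mem' := fun _ => ⟨1, 1, one_pos, one_pos, fun α => by simp⟩
  add_mem' := by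
    intro F G hF hG j
    obtain ⟨M, R, hM, hR, h⟩ := hF j
    obtain ⟨M', R', hM', hR', h'⟩ := hG j
    refine ⟨M + M', max R R', by positivity, lt_max_of_lt_left hR, fun α => ?_⟩
    have h1 : R ^ α.degree ≤ max R R' ^ α.degree :=
      pow_le_pow_left₀ hR.le (le_max_left _ _) _
    have h2 : R' ^ α.degree ≤ max R R' ^ α.degree :=
      pow_le_pow_left₀ hR'.le (le_max_right _ _) _
    calc ‖coeff α ((F + G) j)‖ ≤ ‖coeff α (F j)‖ + ‖coeff α (G j)‖ := by
          simpa using norm_add_le (coeff α (F j)) (coeff α (G j))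
      _ ≤ M * R ^ α.degree + M' * R' ^ α.degree := add_le_add (h α) (h' α)
      _ ≤ M * max R R' ^ α.degree + M' * max R R' ^ α.degree := by gcongr
      _ = (M + M') * max R R' ^ α.degree := by ring
  smul_mem' := by
    intro c F hF j
    obtain ⟨M, R, hM, hR, h⟩ := hF j
    refine ⟨(‖c‖ + 1) * M, R, by positivity, hR, fun α => ?_⟩
    calc ‖coeff α ((c • F) j)‖ = ‖c‖ * ‖coeff α (F j)‖ := by simp
      _ ≤ (‖c‖ + 1) * (M * R ^ α.degree) := by
          gcongr
          · linarith
          · exact h α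
      _ = (‖c‖ + 1) * M * R ^ α.degree := by ring

/-- `(𝓕_{r,m}^{>i})^`: the `r`-tuples of formal power series whose `j`-th component has
zero `(m_j + i)`-jet at the origin. -/
def FormalMaps (𝕜 : Type*) [RCLike 𝕜] (n : ℕ) {r : ℕ} (m : Fin r → ℕ) (i : ℕ) :
    Submodule 𝕜 (Fin r → MvPowerSeries (Fin n) 𝕜) where
  carrier := {F | ∀ j, ((m j + i + 1 : ℕ) : ℕ∞) ≤ (F j).order}
  zero_mem' := fun _ => by simp
  add_mem' := fun hF hG j => le_trans (le_min (hF j) (hG j)) min_order_le_add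
  smul_mem' := fun _ _ hF j => (hF j).trans le_order_smul

/-- `𝓕_{r,m}^{>i} = (𝔸_n)_{>m_1+i} × ⋯ × (𝔸_n)_{>m_r+i}`: the convergent elements of
`FormalMaps 𝕜 n m i`. -/
def AnalyticMaps (𝕜 : Type*) [RCLike 𝕜] (n : ℕ) {r : ℕ} (m : Fin r → ℕ) (i : ℕ) :
    Submodule 𝕜 (Fin r → MvPowerSeries (Fin n) 𝕜) :=
  AnalyticGerms 𝕜 n r ⊓ FormalMaps 𝕜 n m i

/-! ### Orders -/

/-- Order at the origin of a tuple of power series: the lowest degree in which some component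
has a nonzero homogeneous part (`⊤` for the zero tuple). -/
def tupleOrder {𝕜 : Type*} [RCLike 𝕜] {n k : ℕ} (G : Fin k → MvPowerSeries (Fin n) 𝕜) : ℕ∞ :=
  ⨅ j, (G j).order

/-- Order at the origin with respect to the filtration `𝓕_{r,m}^{>i}`: the `j`-th component is
counted in degree `deg - m_j`. (On `FormalMaps 𝕜 n m 0` the subtraction does not truncate.) -/
def filteredOrder {𝕜 : Type*} [RCLike 𝕜] {n r : ℕ} (m : Fin r → ℕ)
    (F : Fin r → MvPowerSeries (Fin n) 𝕜) : ℕ∞ :=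
  ⨅ j, ((F j).order - (m j : ℕ∞))

/-- A map `𝓕_{r,m}^{>0} → 𝔸_n^s` increases the order at the origin by `q`. -/
def IncreasesOrder {𝕜 : Type*} [RCLike 𝕜] {n r s : ℕ} {m : Fin r → ℕ} (q : ℕ)
    (T : AnalyticMaps 𝕜 n m 0 → AnalyticGerms 𝕜 n s) : Prop :=
  ∀ F G : AnalyticMaps 𝕜 n m 0,
    filteredOrder m (F - G).1 + q ≤ tupleOrder (T F - T G).1

/-- A map `𝓕_{r,m}^{>0} → 𝔸_n^s` strictly increases the order at the origin by `q`. The strict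
inequality `a + q < b` is written `a + q + 1 ≤ b`, which is the same thing when `a` is finite and
is the trivial condition `⊤ ≤ ⊤` when `F = G`. -/
def StrictlyIncreasesOrder {𝕜 : Type*} [RCLike 𝕜] {n r s : ℕ} {m : Fin r → ℕ} (q : ℕ)
    (T : AnalyticMaps 𝕜 n m 0 → AnalyticGerms 𝕜 n s) : Prop :=
  ∀ F G : AnalyticMaps 𝕜 n m 0,
    filteredOrder m (F - G).1 + q + 1 ≤ tupleOrder (T F - T G).1

/-! ### Jets and differential analytic maps -/

/-- The partial derivative `∂^{|α|} f / ∂x^α` of a power series: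
its coefficient at `x^β` is `∏ᵢ (βᵢ + αᵢ)! / βᵢ!` times that of `f` at `x^(β + α)`. -/
def partialDeriv {𝕜 : Type*} [RCLike 𝕜] {n : ℕ} (α : Fin n →₀ ℕ)
    (f : MvPowerSeries (Fin n) 𝕜) : MvPowerSeries (Fin n) 𝕜 :=
  fun β => ((∏ i, (β i + α i).descFactorial (α i) : ℕ) : 𝕜) * coeff (β + α) f

/-- Indices `(j, α)`, `|α| ≤ m_j`, of the jet coordinates `u_{j,α}`. -/
abbrev JetIndex (n : ℕ) {r : ℕ} (m : Fin r → ℕ) : Type :=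
  (j : Fin r) × {α : Fin n →₀ ℕ // α.degree ≤ m j}

/-- The coordinates `(x, u_{j,α})` of the jet space: `n` base coordinates and the jet
coordinates. -/
abbrev JetCoord (n : ℕ) {r : ℕ} (m : Fin r → ℕ) : Type := Fin n ⊕ JetIndex n m

instance finite_jetIndex (n : ℕ) {r : ℕ} (m : Fin r → ℕ) : Finite (JetIndex n m) := by
  have : ∀ j : Fin r, Finite {α : Fin n →₀ ℕ // α.degree ≤ m j} := fun j =>
    (Finsupp.finite_of_degree_le (σ := Fin n) (m j)).to_subtype
  infer_instance

/-- The tuple `(x, ∂F)` of power series in `x`, where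
`∂F = (∂^{|α|} F_j / ∂x^α : 1 ≤ j ≤ r, |α| ≤ m_j)`. -/
def jet {𝕜 : Type*} [RCLike 𝕜] {n r : ℕ} (m : Fin r → ℕ)
    (F : Fin r → MvPowerSeries (Fin n) 𝕜) : JetCoord n m → MvPowerSeries (Fin n) 𝕜 :=
  Sum.elim (fun i => X i) (fun v => partialDeriv v.2.1 (F v.1))

/-- For `F` in `FormalMaps 𝕜 n m 0` all the components of `(x, ∂F)` vanish at the origin, so they
may be substituted in any power series in the jet coordinates. -/
theorem hasSubst_jet {𝕜 : Type*} [RCLike 𝕜] {n r : ℕ} {m : Fin r → ℕ}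
    {F : Fin r → MvPowerSeries (Fin n) 𝕜} (hF : F ∈ FormalMaps 𝕜 n m 0) :
    HasSubst (jet m F) := by
  apply hasSubst_of_constantCoeff_zero
  rintro (i | ⟨j, α, hα⟩)
  · simp [jet]
  · have h : coeff α (F j) = 0 := by
      apply coeff_of_lt_order
      refine lt_of_lt_of_le ?_ (hF j)
      exact_mod_cast Nat.lt_succ_of_le hα
    change ((∏ i, ((0 : Fin n →₀ ℕ) i + α i).descFactorial (α i) : ℕ) : 𝕜) *
      coeff (0 + α) (F j) = 0
    rw [zero_add, h, mul_zero]

/-- `T` is the differential analytic map of order `m` given by `W`: here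
`W = (W_1, …, W_s)` is (the Taylor series of) a germ at `0` of an analytic map with `W(0) = 0` on
the jet space, and `T(F)(x) = W(x, ∂F(x))`. All `m_j`-jets of `F ∈ 𝓕_{r,m}^{>0}` at the origin
vanish, so that the composition is defined for every `F`. -/
structure IsDifferentialMap {𝕜 : Type*} [RCLike 𝕜] {n r s : ℕ} {m : Fin r → ℕ}
    (W : Fin s → MvPowerSeries (JetCoord n m) 𝕜)
    (T : AnalyticMaps 𝕜 n m 0 → AnalyticGerms 𝕜 n s) : Prop where
  convergent : ∀ i, IsConvergent (W i)
  map_zero : ∀ i, constantCoeff (W i) = 0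
  eq_subst : ∀ (F : AnalyticMaps 𝕜 n m 0) (i : Fin s), (T F).1 i = subst (jet m F.1) (W i)

/-- Regularity of the differential map given by `W`: for all formal `F` in
`FormalMaps 𝕜 n m 0`, the series `(∂W_i/∂u_{j,α})(x, ∂F)` has order at least
`p_{j,|α|} = max(0, |α| + q + 1 - m_j)` (truncated subtraction). -/
def IsRegular {𝕜 : Type*} [RCLike 𝕜] {n r s : ℕ} {m : Fin r → ℕ} (q : ℕ)
    (W : Fin s → MvPowerSeries (JetCoord n m) 𝕜) : Prop :=
  ∀ F ∈ FormalMaps 𝕜 n m 0, ∀ (i : Fin s) (v : JetIndex n m),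
    ((v.2.1.degree + q + 1 - m v.1 : ℕ) : ℕ∞) ≤
      (subst (jet m F) (pderiv 𝕜 (Sum.inr v) (W i))).order

/-! ### Norms of homogeneous parts and majorants -/

/-- The norm `‖f^{(i)}‖ = ∑_{|α| = i} |f_α|` of the homogeneous part of degree `i` of `f`. -/
def homNorm {𝕜 : Type*} [RCLike 𝕜] {n : ℕ} (i : ℕ) (f : MvPowerSeries (Fin n) 𝕜) : ℝ :=
  ∑ α ∈ (Finset.univ : Finset (Fin n)).finsuppAntidiag i, ‖coeff α f‖

/-- The one variable power series `F̂(z) = ∑ᵢ ‖F^{(i)}‖ zⁱ`, where the norm of a tuple is the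
maximum of the norms of its components. -/
def hat {𝕜 : Type*} [RCLike 𝕜] {n k : ℕ} (F : Fin k → MvPowerSeries (Fin n) 𝕜) :
    PowerSeries ℝ :=
  PowerSeries.mk fun i => ⨆ j, homNorm i (F j)

/-- `f ≺ g` for real power series in one variable. -/
def Dominated (f g : PowerSeries ℝ) : Prop :=
  ∀ p, 0 ≤ PowerSeries.coeff p g ∧ |PowerSeries.coeff p f| ≤ PowerSeries.coeff p g

/-! ### Big denominators -/

/-- The big denominators property of order `m` of the triple `(S, T, π)`, with the integer `q`. -/
structure BigDenominatorsWith {𝕜 : Type*} [RCLike 𝕜] {n r s : ℕ} {m : Fin r → ℕ}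
    (S : AnalyticMaps 𝕜 n m 0 →ₗ[𝕜] AnalyticGerms 𝕜 n s)
    (T : AnalyticMaps 𝕜 n m 0 → AnalyticGerms 𝕜 n s)
    (π : AnalyticGerms 𝕜 n s →ₗ[𝕜] LinearMap.range S) (q : ℕ) : Prop where
  /-- `T` is a regular differential analytic map of order `m`. -/
  regular : ∃ W : Fin s → MvPowerSeries (JetCoord n m) 𝕜, IsDifferentialMap W T ∧ IsRegular q W
  strict : StrictlyIncreasesOrder q T
  /-- The `q`-jet of `T(0)` at the origin vanishes. -/
  jet_zero : ((q + 1 : ℕ) : ℕ∞) ≤ tupleOrder (T 0).1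
  increases : IncreasesOrder q S
  /-- `π` is a projection onto the image of `S`. -/
  proj : ∀ y : LinearMap.range S, π y = y
  /-- `S` has a right inverse `R` with `d^{m_i}/dz^{m_i} (z^q (R_i (π G))^) ≺ C Ĝ`. -/
  estimate : ∃ R : LinearMap.range S → AnalyticMaps 𝕜 n m 0, (∀ y, S (R y) = y) ∧
    ∃ C : ℝ, 0 < C ∧ ∀ G : AnalyticGerms 𝕜 n s, ((q + 1 : ℕ) : ℕ∞) ≤ tupleOrder G.1 →
      ∀ i : Fin r,
        Dominated
          ((PowerSeries.derivative ℝ)^[m i]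
            (PowerSeries.X ^ q * hat (fun _ : Fin 1 => (R (π G)).1 i)))
          (C • hat G.1)

/-- The big denominators property of order `m` of the triple `(S, T, π)`. -/
def HasBigDenominators {𝕜 : Type*} [RCLike 𝕜] {n r s : ℕ} {m : Fin r → ℕ}
    (S : AnalyticMaps 𝕜 n m 0 →ₗ[𝕜] AnalyticGerms 𝕜 n s)
    (T : AnalyticMaps 𝕜 n m 0 → AnalyticGerms 𝕜 n s)
    (π : AnalyticGerms 𝕜 n s →ₗ[𝕜] LinearMap.range S) : Prop :=
  ∃ q : ℕ, BigDenominatorsWith S T π q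

end BigDenom

end

/-! The solution is the limit of the corrections `P₀ = 0`, `P_{k+1} = P_k + R (π (T P_k) - S P_k)`,
where `R` is the right inverse of `S`. Then `S P_{k+1} = π (T P_k)`, so every later increment has
the form `R (π (T P_{k+1} - T P_k))`. The estimate on `R ∘ π` is thus applied to increments
directly, and `R` need not be linear.

Formally, `T` raises orders by `q + 1` and `R ∘ π` lowers them by at most `q`, so the increment
`P_{k+1} - P_k` has filtered order at least `k + 1` (`le_order_picardIterate_sub`). The iterates
therefore stabilise coefficientwise, and the two sides of the equation agree at the limit to every
order (`map_eq_of_le_order_sub`).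

Analytically, two norms depending on a radius `ρ` are used. `absNorm ρ` is the weighted `ℓ¹` norm;
`jetNorm` evaluates at `ρ` the series occurring in the big denominators estimate, so on series of
order at least `q + 1` the map `R ∘ π` is bounded between them uniformly in `ρ`
(`jetNorm_le_of_dominated`). The jet norm controls `∂^α F_j` for `|α| ≤ m_j` up to a factor `ρ^(m_j
- |α| - q)`.

This loss is recovered by `T`, which contracts by `O(ρ)` near `P_q`
(`exists_absNorm_subst_jet_sub_le`). Expand `W` at the jet of `P_q`: regularity makes the linear
coefficients `O(ρ^(|α| + q + 1 - m_j))`, which leaves one spare `ρ`. In the quadratic remainder one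
factor costs `ρ^(-q)` and the other is `O(ρ^(q+1))`, provided the variations have jet norm
`O(ρ^(2q+1))`. This is why the expansion is centred at `P_q` and not at `0`: `P_{q+1} - P_q` has
filtered order at least `q + 1`, hence jet norm `O(ρ^(2q+1))`. For small `ρ` the increments from
`P_q` on at least halve, the iterates stay bounded (`exists_absNorm_picardIterate_le`), and so do
the coefficients of the limit. -/

noncomputable section

namespace BigDenom

open MvPowerSeries Filter
open scoped ENNReal NNReal Topology

/-! ### The weighted `ℓ¹` norm of a power series -/

section AbsNorm

variable {𝕜 : Type*} [RCLike 𝕜] {σ τ : Type*}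

/-- The weighted `ℓ¹` norm `∑ |f_α| ρ^|α|` of a power series on the polydisc of radius `ρ`. -/
def absNorm (ρ : ℝ≥0) (f : MvPowerSeries σ 𝕜) : ℝ≥0∞ :=
  ∑' α : σ →₀ ℕ, ‖coeff α f‖ₑ * (ρ : ℝ≥0∞) ^ α.degree

theorem coeff_le_absNorm (ρ : ℝ≥0) (f : MvPowerSeries σ 𝕜) (α : σ →₀ ℕ) :
    ‖coeff α f‖ₑ * (ρ : ℝ≥0∞) ^ α.degree ≤ absNorm ρ f :=
  ENNReal.le_tsum (f := fun α => ‖coeff α f‖ₑ * (ρ : ℝ≥0∞) ^ α.degree) α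

theorem absNorm_add_le (ρ : ℝ≥0) (f g : MvPowerSeries σ 𝕜) :
    absNorm ρ (f + g) ≤ absNorm ρ f + absNorm ρ g := by
  rw [absNorm, absNorm, absNorm, ← ENNReal.tsum_add]
  refine ENNReal.tsum_le_tsum fun α => ?_
  rw [← add_mul, map_add]
  gcongr
  exact enorm_add_le _ _

@[simp]
theorem absNorm_zero (ρ : ℝ≥0) : absNorm ρ (0 : MvPowerSeries σ 𝕜) = 0 := by
  simp [absNorm]

theorem absNorm_sum_le {ι : Type*} (ρ : ℝ≥0) (s : Finset ι) (f : ι → MvPowerSeries σ 𝕜) :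
    absNorm ρ (∑ i ∈ s, f i) ≤ ∑ i ∈ s, absNorm ρ (f i) := by
  classical
  induction s using Finset.induction_on with
  | empty => simp
  | insert a s ha ih =>
    rw [Finset.sum_insert ha, Finset.sum_insert ha]
    exact (absNorm_add_le _ _ _).trans (by gcongr)

theorem absNorm_one (ρ : ℝ≥0) : absNorm ρ (1 : MvPowerSeries σ 𝕜) = 1 := by
  classical
  rw [absNorm, tsum_eq_single 0]
  · simp
  · intro α hα
    simp [coeff_one, hα]

theorem absNorm_mul_le (ρ : ℝ≥0) (f g : MvPowerSeries σ 𝕜) :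
    absNorm ρ (f * g) ≤ absNorm ρ f * absNorm ρ g := by
  classical
  rw [absNorm, absNorm, absNorm, ← ENNReal.tsum_mul_right]
  simp_rw [← ENNReal.tsum_mul_left]
  rw [← ENNReal.tsum_prod (f := fun α β => ‖coeff α f‖ₑ * (ρ : ℝ≥0∞) ^ α.degree *
      (‖coeff β g‖ₑ * (ρ : ℝ≥0∞) ^ β.degree)),
    ← Finset.HasAntidiagonal.sigmaAntidiagonalEquivProd.tsum_eq, ENNReal.tsum_sigma']
  refine ENNReal.tsum_le_tsum fun α => ?_
  rw [tsum_fintype, coeff_mul, Finset.univ_eq_attach]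
  change _ ≤ ∑ x ∈ (Finset.HasAntidiagonal.antidiagonal α).attach,
    ‖coeff x.1.1 f‖ₑ * (ρ : ℝ≥0∞) ^ x.1.1.degree *
      (‖coeff x.1.2 g‖ₑ * (ρ : ℝ≥0∞) ^ x.1.2.degree)
  rw [Finset.sum_attach (Finset.HasAntidiagonal.antidiagonal α) (fun x => ‖coeff x.1 f‖ₑ *
    (ρ : ℝ≥0∞) ^ x.1.degree * (‖coeff x.2 g‖ₑ * (ρ : ℝ≥0∞) ^ x.2.degree))]
  calc _ ≤ (∑ x ∈ Finset.HasAntidiagonal.antidiagonal α, ‖coeff x.1 f * coeff x.2 g‖ₑ) *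
        (ρ : ℝ≥0∞) ^ α.degree := by gcongr; exact enorm_sum_le _ _
    _ = _ := by
      rw [Finset.sum_mul]
      refine Finset.sum_congr rfl fun x hx => ?_
      rw [← Finset.HasAntidiagonal.mem_antidiagonal.1 hx, map_add, pow_add, enorm_mul]
      ring

theorem absNorm_mono {ρ ρ' : ℝ≥0} (h : ρ ≤ ρ') (f : MvPowerSeries σ 𝕜) :
    absNorm ρ f ≤ absNorm ρ' f := by
  unfold absNorm
  gcongr

/-- A power series of order at least `p` is `O(ρ^p)` on the polydisc of radius `ρ`. -/
theorem absNorm_mul_pow_le {ρ ρ' : ℝ≥0} (h : ρ ≤ ρ') {f : MvPowerSeries σ 𝕜} {p : ℕ}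
    (hf : (p : ℕ∞) ≤ f.order) :
    absNorm ρ f * (ρ' : ℝ≥0∞) ^ p ≤ (ρ : ℝ≥0∞) ^ p * absNorm ρ' f := by
  rw [absNorm, absNorm, ← ENNReal.tsum_mul_right, ← ENNReal.tsum_mul_left]
  refine ENNReal.tsum_le_tsum fun α => ?_
  by_cases hα : α.degree < p
  · rw [coeff_of_lt_order (lt_of_lt_of_le (by exact_mod_cast hα) hf)]
    simp
  · obtain ⟨k, hk⟩ := Nat.exists_eq_add_of_le (not_lt.1 hα)
    have h' : (ρ : ℝ≥0∞) ≤ ρ' := by exact_mod_cast h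
    rw [hk, pow_add, pow_add]
    calc ‖coeff α f‖ₑ * ((ρ : ℝ≥0∞) ^ p * (ρ : ℝ≥0∞) ^ k) * (ρ' : ℝ≥0∞) ^ p
        ≤ ‖coeff α f‖ₑ * ((ρ : ℝ≥0∞) ^ p * (ρ' : ℝ≥0∞) ^ k) * (ρ' : ℝ≥0∞) ^ p := by gcongr
      _ = _ := by ring

/-- Each variable contributes one geometric series, so the sum is a finite product of such series;
the induction splits off one variable at a time. -/
theorem tsum_pow_degree_ne_top [Finite σ] {x : ℝ≥0∞} (hx : x < 1) :
    ∑' α : σ →₀ ℕ, x ^ α.degree ≠ ∞ := by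
  induction σ using Finite.induction_empty_option with
  | of_equiv e ih =>
    rw [← (Finsupp.domCongr (M := ℕ) e).toEquiv.tsum_eq]
    convert ih using 3 with α
    congr 1
    change (Finsupp.equivMapDomain e α).degree = _
    rw [Finsupp.equivMapDomain_eq_mapDomain, Finsupp.degree_mapDomain]
  | h_empty => simp [tsum_fintype]
  | h_option ih =>
    rename_i σ _
    have key : ∀ p : ℕ × (σ →₀ ℕ), x ^ (Finsupp.optionEquiv.symm p : Option σ →₀ ℕ).degree =
        x ^ p.1 * x ^ p.2.degree := by
      intro p
      rw [← pow_add]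
      congr 1
      rw [Finsupp.degree_eq_sum, Finsupp.degree_eq_sum, Fintype.sum_option]
      congr 1
      · exact Finsupp.optionElim_apply_none _ _
      · exact Finset.sum_congr rfl fun i _ => Finsupp.optionElim_apply_some _ _ _
    rw [← Finsupp.optionEquiv.symm.tsum_eq]
    simp_rw [key]
    rw [ENNReal.tsum_prod']
    simp_rw [ENNReal.tsum_mul_left, ENNReal.tsum_mul_right, ENNReal.tsum_geometric]
    exact ENNReal.mul_ne_top (ENNReal.inv_ne_top.2 (tsub_pos_of_lt hx).ne') ih

theorem IsConvergent.exists_absNorm_ne_top [Finite σ] {f : MvPowerSeries σ 𝕜}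
    (hf : IsConvergent f) : ∃ ρ : ℝ≥0, 0 < ρ ∧ absNorm ρ f ≠ ∞ := by
  obtain ⟨M, R, hM, hR, h⟩ := hf
  lift M to ℝ≥0 using hM.le
  lift R to ℝ≥0 using hR.le
  have hR' : 0 < R := by exact_mod_cast hR
  -- Half the radius suggested by the coefficient bound leaves the summable ratio `1/2`.
  refine ⟨(2 * R)⁻¹, by positivity, ?_⟩
  have key : absNorm (2 * R)⁻¹ f ≤
      ∑' α : σ →₀ ℕ, (M : ℝ≥0∞) * ((2⁻¹ : ℝ≥0) : ℝ≥0∞) ^ α.degree := by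
    refine ENNReal.tsum_le_tsum fun α => ?_
    have h1 : ‖coeff α f‖₊ ≤ M * R ^ α.degree := by exact_mod_cast h α
    rw [enorm_eq_nnnorm]
    have h2 : ‖coeff α f‖₊ * (2 * R)⁻¹ ^ α.degree ≤ M * 2⁻¹ ^ α.degree := by
      calc ‖coeff α f‖₊ * (2 * R)⁻¹ ^ α.degree ≤ M * R ^ α.degree * (2 * R)⁻¹ ^ α.degree := by
            gcongr
        _ = M * (R * (2 * R)⁻¹) ^ α.degree := by rw [mul_pow]; ring
        _ = _ := by
          congr 2
          field_simp
    exact_mod_cast h2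
  refine ne_top_of_le_ne_top ?_ key
  rw [ENNReal.tsum_mul_left]
  refine ENNReal.mul_ne_top ENNReal.coe_ne_top (tsum_pow_degree_ne_top ?_)
  rw [← ENNReal.coe_one, ENNReal.coe_lt_coe, ← NNReal.coe_lt_coe]
  norm_num

/-- Coefficient bounds by a common geometric sequence characterise convergence. -/
theorem isConvergent_of_coeff_mul_pow_le {ρ : ℝ≥0} (hρ : 0 < ρ) {f : MvPowerSeries σ 𝕜}
    {M : ℝ≥0∞} (hM : M ≠ ∞) (h : ∀ α, ‖coeff α f‖ₑ * (ρ : ℝ≥0∞) ^ α.degree ≤ M) :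
    IsConvergent f := by
  lift M to ℝ≥0 using hM
  refine ⟨M + 1, (ρ : ℝ)⁻¹, by positivity, by positivity, fun α => ?_⟩
  have h1 : ‖coeff α f‖₊ * ρ ^ α.degree ≤ M := by
    have := h α
    rw [enorm_eq_nnnorm] at this
    exact_mod_cast this
  have h2 : ‖coeff α f‖ * (ρ : ℝ) ^ α.degree ≤ M := by exact_mod_cast h1
  have h3 : (0 : ℝ) < (ρ : ℝ) ^ α.degree := by positivity
  rw [inv_pow, ← div_eq_mul_inv, le_div_iff₀ h3]
  linarith

theorem IsConvergent.pderiv {f : MvPowerSeries σ 𝕜} (hf : IsConvergent f) (v : σ) :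
    IsConvergent (MvPowerSeries.pderiv 𝕜 v f) := by
  obtain ⟨M, R, hM, hR, h⟩ := hf
  refine ⟨M * R, R * 2, by positivity, by positivity, fun α => ?_⟩
  rw [coeff_pderiv, norm_mul]
  have h1 : ‖((α v : 𝕜) + 1)‖ ≤ 2 ^ α.degree := by
    have h2 : ‖((α v : 𝕜) + 1)‖ = ((α v + 1 : ℕ) : ℝ) := by
      rw [← RCLike.norm_natCast (K := 𝕜)]
      push_cast
      rfl
    rw [h2]
    have h3 : α v ≤ α.degree := Finsupp.le_degree v α
    exact_mod_cast (Nat.succ_le_of_lt (Nat.lt_of_le_of_lt h3 (Nat.lt_two_pow_self)))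
  calc _ ≤ M * R ^ (α + Finsupp.single v 1).degree * 2 ^ α.degree :=
        mul_le_mul (h _) h1 (norm_nonneg _) (by positivity)
    _ = _ := by
      rw [map_add, Finsupp.degree_single, pow_succ, mul_pow]
      ring

end AbsNorm

/-! ### Locally finite sums of power series -/

section FormalSum

variable {ι σ τ R : Type*} [CommRing R]

/-- `g` is the coefficientwise finite sum of the family `Q` of power series. -/
def IsFormalSum (Q : ι → MvPowerSeries τ R) (g : MvPowerSeries τ R) : Prop :=
  ∀ e, (fun i => coeff e (Q i)).HasFiniteSupport ∧ coeff e g = ∑ᶠ i, coeff e (Q i)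

theorem IsFormalSum.sub {Q Q' : ι → MvPowerSeries τ R} {g g' : MvPowerSeries τ R}
    (h : IsFormalSum Q g) (h' : IsFormalSum Q' g') :
    IsFormalSum (fun i => Q i - Q' i) (g - g') := by
  intro e
  simp only [map_sub]
  exact ⟨(h e).1.sub (h' e).1, by rw [(h e).2, (h' e).2, finsum_sub_distrib (h e).1 (h' e).1]⟩

theorem IsFormalSum.sum {κ : Type*} (s : Finset κ) {Q : κ → ι → MvPowerSeries τ R}
    {g : κ → MvPowerSeries τ R} (h : ∀ k ∈ s, IsFormalSum (Q k) (g k)) :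
    IsFormalSum (fun i => ∑ k ∈ s, Q k i) (∑ k ∈ s, g k) := by
  intro e
  simp only [map_sum]
  refine ⟨?_, ?_⟩
  · refine (s.finite_toSet.biUnion fun k hk => (h k hk e).1).subset fun i hi => ?_
    by_contra hcon
    simp only [Set.mem_iUnion, not_exists, Function.mem_support, not_not] at hcon
    exact hi (Finset.sum_eq_zero fun k hk => hcon k hk)
  · rw [finsum_sum_comm s _ fun k hk => (h k hk e).1]
    exact Finset.sum_congr rfl fun k hk => (h k hk e).2

theorem IsFormalSum.mul_right {Q : ι → MvPowerSeries τ R} {g : MvPowerSeries τ R}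
    (h : IsFormalSum Q g) (d : MvPowerSeries τ R) :
    IsFormalSum (fun i => Q i * d) (g * d) := by
  classical
  intro e
  simp only [coeff_mul]
  have hfin : ∀ p : (τ →₀ ℕ) × (τ →₀ ℕ),
      (fun i => coeff p.1 (Q i) * coeff p.2 d).HasFiniteSupport := fun p =>
    (h p.1).1.subset fun i hi hcon => hi (by
      simp only at hcon ⊢
      rw [hcon, zero_mul])
  refine ⟨?_, ?_⟩
  · refine ((Finset.HasAntidiagonal.antidiagonal e).finite_toSet.biUnion
      fun k _ => hfin k).subset fun i hi => ?_
    by_contra hcon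
    simp only [Set.mem_iUnion, not_exists, Function.mem_support, not_not] at hcon
    exact hi (Finset.sum_eq_zero fun k hk => hcon k hk)
  · rw [finsum_sum_comm _ _ fun k _ => hfin k]
    refine Finset.sum_congr rfl fun k _ => ?_
    rw [(h k.1).2, finsum_mul' _ _ (h k.1).1]

theorem aeval_monomial_add_single {A : Type*} [CommRing A] [Algebra R A] (a : σ → A)
    (γ : σ →₀ ℕ) (v : σ) :
    MvPolynomial.aeval a (MvPolynomial.monomial (γ + Finsupp.single v 1) (1 : R)) =
      MvPolynomial.aeval a (MvPolynomial.monomial γ (1 : R)) * a v := by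
  rw [MvPolynomial.monomial_add_single, pow_one, map_mul, MvPolynomial.aeval_X]

theorem isFormalSum_subst {a : σ → MvPowerSeries τ R} (ha : HasSubst a) (f : MvPowerSeries σ R) :
    IsFormalSum (fun γ => coeff γ f • MvPolynomial.aeval a (MvPolynomial.monomial γ (1 : R)))
      (subst a f) := by
  intro e
  have key : ∀ γ, coeff e (coeff γ f • MvPolynomial.aeval a (MvPolynomial.monomial γ (1 : R))) =
      coeff γ f • coeff e (γ.prod fun s e => a s ^ e) := by
    intro γ
    rw [MvPolynomial.aeval_monomial, map_one, one_mul]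
    rfl
  simp_rw [key]
  exact ⟨coeff_subst_finite ha f e, coeff_subst ha f e⟩

/-- Indexing by the monomials of `f` itself, instead of those of its derivative, lets the derivative
terms be subtracted termwise from the expansions of the substitutions. The two indexings differ by
the shift `γ ↦ γ + single v 1`; monomials outside its range do not involve `v` and have zero
derivative. -/
theorem isFormalSum_subst_pderiv {a : σ → MvPowerSeries τ R} (ha : HasSubst a)
    (f : MvPowerSeries σ R) (v : σ) :
    IsFormalSum (fun γ => coeff γ f • MvPolynomial.aeval a
        (MvPolynomial.pderiv v (MvPolynomial.monomial γ (1 : R))))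
      (subst a (MvPowerSeries.pderiv R v f)) := by
  classical
  intro e
  obtain ⟨hfin, hsum⟩ := isFormalSum_subst ha (MvPowerSeries.pderiv R v f) e
  set Q : (σ →₀ ℕ) → R := fun γ => coeff e (coeff γ f • MvPolynomial.aeval a
        (MvPolynomial.pderiv v (MvPolynomial.monomial γ (1 : R)))) with hQ
  have hinj : Function.Injective fun γ : σ →₀ ℕ => γ + Finsupp.single v 1 :=
    add_left_injective _
  have hcomp : (fun γ => coeff e (coeff γ (MvPowerSeries.pderiv R v f) •
      MvPolynomial.aeval a (MvPolynomial.monomial γ (1 : R)))) =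
      fun γ => Q (γ + Finsupp.single v 1) := by
    funext γ
    simp only [hQ, MvPolynomial.pderiv_monomial, coeff_pderiv, add_tsub_cancel_right, one_mul]
    rw [MvPolynomial.aeval_monomial, MvPolynomial.aeval_monomial, map_one, one_mul,
      ← Algebra.smul_def, map_smul, map_smul, map_smul, smul_eq_mul, smul_eq_mul, smul_eq_mul,
      ← mul_assoc]
    simp
  have hsupp : Function.support Q ⊆ Set.range fun γ : σ →₀ ℕ => γ + Finsupp.single v 1 := by
    intro γ hγ
    by_cases h0 : γ v = 0
    · exact absurd (by simp [hQ, MvPolynomial.pderiv_monomial, h0]) hγ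
    · exact ⟨γ - Finsupp.single v 1, tsub_add_cancel_of_le (by
        simpa [Finsupp.single_le_iff] using Nat.one_le_iff_ne_zero.2 h0)⟩
  rw [hcomp] at hfin hsum
  refine ⟨?_, ?_⟩
  · refine (hfin.image fun γ : σ →₀ ℕ => γ + Finsupp.single v 1).subset fun γ hγ => ?_
    obtain ⟨δ, rfl⟩ := hsupp hγ
    exact ⟨δ, hγ, rfl⟩
  · rw [hsum, ← finsum_mem_range (f := Q) hinj, finsum_mem_def, Set.indicator_eq_self.2 hsupp]

end FormalSum

/-! ### Norm estimates for substitution and its first order Taylor expansion -/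

section Subst

variable {𝕜 : Type*} [RCLike 𝕜] {ι σ τ : Type*}

theorem finsupp_induction_add_single {motive : (σ →₀ ℕ) → Prop} (zero : motive 0)
    (add_single : ∀ γ v, motive γ → motive (γ + Finsupp.single v 1)) (γ : σ →₀ ℕ) :
    motive γ := by
  classical
  induction hd : γ.degree generalizing γ with
  | zero => rwa [(Finsupp.degree_eq_zero_iff γ).1 hd]
  | succ d ih =>
    have h0 : γ ≠ 0 := by
      rintro rfl
      simp at hd
    obtain ⟨v, hv⟩ := Finsupp.ne_iff.1 h0
    have hle : Finsupp.single v 1 ≤ γ := by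
      simpa [Finsupp.single_le_iff] using Nat.one_le_iff_ne_zero.2 hv
    have hγ : γ - Finsupp.single v 1 + Finsupp.single v 1 = γ := tsub_add_cancel_of_le hle
    rw [← hγ]
    refine add_single _ _ (ih _ ?_)
    have := congrArg Finsupp.degree hγ
    rw [map_add, Finsupp.degree_single] at this
    omega

theorem enorm_finsum_le (c : ι → 𝕜) : ‖∑ᶠ i, c i‖ₑ ≤ ∑' i, ‖c i‖ₑ := by
  by_cases h : c.HasFiniteSupport
  · rw [finsum_eq_sum c h]
    exact (enorm_sum_le _ _).trans (ENNReal.sum_le_tsum _)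
  · rw [finsum_of_not_hasFiniteSupport h]
    simp

theorem IsFormalSum.absNorm_le {Q : ι → MvPowerSeries τ 𝕜} {g : MvPowerSeries τ 𝕜}
    (h : IsFormalSum Q g) (ρ : ℝ≥0) : absNorm ρ g ≤ ∑' i, absNorm ρ (Q i) := by
  unfold absNorm
  rw [ENNReal.tsum_comm]
  refine ENNReal.tsum_le_tsum fun e => ?_
  rw [(h e).2, ENNReal.tsum_mul_right]
  gcongr
  exact enorm_finsum_le _

theorem absNorm_smul (ρ : ℝ≥0) (c : 𝕜) (f : MvPowerSeries σ 𝕜) :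
    absNorm ρ (c • f) = ‖c‖ₑ * absNorm ρ f := by
  unfold absNorm
  rw [← ENNReal.tsum_mul_left]
  refine tsum_congr fun α => ?_
  rw [map_smul, smul_eq_mul, enorm_mul, mul_assoc]

theorem absNorm_aeval_monomial_le {ρ t : ℝ≥0} {a : σ → MvPowerSeries τ 𝕜}
    (ha : ∀ v, absNorm ρ (a v) ≤ t) (γ : σ →₀ ℕ) :
    absNorm ρ (MvPolynomial.aeval a (MvPolynomial.monomial γ (1 : 𝕜))) ≤
      (t : ℝ≥0∞) ^ γ.degree := by
  induction γ using finsupp_induction_add_single with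
  | zero => simp [absNorm_one]
  | add_single γ v ih =>
    rw [aeval_monomial_add_single, map_add, Finsupp.degree_single, pow_succ]
    exact (absNorm_mul_le _ _ _).trans (mul_le_mul' ih (ha v))

theorem absNorm_subst_le {ρ t : ℝ≥0} {a : σ → MvPowerSeries τ 𝕜} (hs : HasSubst a)
    (ha : ∀ v, absNorm ρ (a v) ≤ t) (f : MvPowerSeries σ 𝕜) :
    absNorm ρ (subst a f) ≤ absNorm t f := by
  refine ((isFormalSum_subst hs f).absNorm_le ρ).trans (ENNReal.tsum_le_tsum fun γ => ?_)
  rw [absNorm_smul]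
  gcongr
  exact absNorm_aeval_monomial_le ha γ

/-- The linear part in `d` of the monomial `(u + d)^γ`. -/
def monomialLinearPart [Fintype σ] (u d : σ → MvPowerSeries τ 𝕜) (γ : σ →₀ ℕ) :
    MvPowerSeries τ 𝕜 :=
  ∑ v, MvPolynomial.aeval u (MvPolynomial.pderiv v (MvPolynomial.monomial γ (1 : 𝕜))) * d v

theorem monomialLinearPart_add_single [Fintype σ] (u d : σ → MvPowerSeries τ 𝕜) (γ : σ →₀ ℕ)
    (v : σ) :
    monomialLinearPart u d (γ + Finsupp.single v 1) = monomialLinearPart u d γ * u v +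
      MvPolynomial.aeval u (MvPolynomial.monomial γ (1 : 𝕜)) * d v := by
  classical
  have h : ∀ w, MvPolynomial.aeval u (MvPolynomial.pderiv w
      (MvPolynomial.monomial (γ + Finsupp.single v 1) (1 : 𝕜))) * d w =
      MvPolynomial.aeval u (MvPolynomial.pderiv w (MvPolynomial.monomial γ (1 : 𝕜))) * d w * u v +
      if w = v then MvPolynomial.aeval u (MvPolynomial.monomial γ (1 : 𝕜)) * d v else 0 := by
    intro w
    rw [MvPolynomial.monomial_add_single, pow_one, Derivation.leibniz, map_add, smul_eq_mul,
      smul_eq_mul, map_mul, map_mul, MvPolynomial.aeval_X]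
    split_ifs with hw
    · subst hw
      rw [MvPolynomial.pderiv_X_self, map_one (MvPolynomial.aeval u)]
      ring
    · rw [MvPolynomial.pderiv_X_of_ne (Ne.symm hw), map_zero]
      ring
  unfold monomialLinearPart
  simp_rw [h]
  rw [Finset.sum_add_distrib, Finset.sum_mul, Finset.sum_ite_eq' Finset.univ v]
  simp

/-- Mean value estimate for monomials, by telescoping one variable at a time. The factor `t` on the
left avoids the exponent `γ.degree - 1`. -/
theorem absNorm_aeval_monomial_sub_le {ρ t : ℝ≥0} {D : ℝ≥0∞} {a b : σ → MvPowerSeries τ 𝕜}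
    (ha : ∀ v, absNorm ρ (a v) ≤ t) (hb : ∀ v, absNorm ρ (b v) ≤ t)
    (hD : ∀ v, absNorm ρ (a v - b v) ≤ D) (γ : σ →₀ ℕ) :
    t * absNorm ρ (MvPolynomial.aeval a (MvPolynomial.monomial γ (1 : 𝕜)) -
        MvPolynomial.aeval b (MvPolynomial.monomial γ (1 : 𝕜))) ≤
      γ.degree * D * (t : ℝ≥0∞) ^ γ.degree := by
  induction γ using finsupp_induction_add_single with
  | zero => simp
  | add_single γ v ih =>
    rw [aeval_monomial_add_single, aeval_monomial_add_single, map_add, Finsupp.degree_single,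
      pow_succ]
    set A := MvPolynomial.aeval a (MvPolynomial.monomial γ (1 : 𝕜))
    set B := MvPolynomial.aeval b (MvPolynomial.monomial γ (1 : 𝕜)) with hB
    have e : A * a v - B * b v = (A - B) * a v + B * (a v - b v) := by ring
    rw [e]
    calc (t : ℝ≥0∞) * absNorm ρ ((A - B) * a v + B * (a v - b v))
        ≤ t * (absNorm ρ (A - B) * absNorm ρ (a v) + absNorm ρ B * absNorm ρ (a v - b v)) := by
          gcongr
          exact (absNorm_add_le _ _ _).trans (add_le_add (absNorm_mul_le _ _ _)
            (absNorm_mul_le _ _ _))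
      _ ≤ t * (absNorm ρ (A - B) * t + (t : ℝ≥0∞) ^ γ.degree * D) := by
          gcongr
          · exact ha v
          · exact absNorm_aeval_monomial_le hb γ
          · exact hD v
      _ = t * absNorm ρ (A - B) * t + (t : ℝ≥0∞) ^ γ.degree * t * D := by ring
      _ ≤ γ.degree * D * (t : ℝ≥0∞) ^ γ.degree * t + (t : ℝ≥0∞) ^ γ.degree * t * D := by gcongr
      _ = _ := by push_cast; ring

/-- Adding one variable multiplies the old remainder by `u v` and creates two cross terms, each a
product of a first order difference and a variation; the mean value estimate bounds both by `D * M`.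
The constant closes because `d² + 2d ≤ (d + 1)²`. -/
theorem absNorm_aeval_monomial_remainder_le [Fintype σ] {ρ t : ℝ≥0} {D M : ℝ≥0∞}
    {u h h' : σ → MvPowerSeries τ 𝕜} (hu : ∀ v, absNorm ρ (u v) ≤ t)
    (huh : ∀ v, absNorm ρ (u v + h v) ≤ t) (huh' : ∀ v, absNorm ρ (u v + h' v) ≤ t)
    (hM : ∀ v, absNorm ρ (h v) ≤ M) (hM' : ∀ v, absNorm ρ (h' v) ≤ M)
    (hD : ∀ v, absNorm ρ (h v - h' v) ≤ D) (γ : σ →₀ ℕ) :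
    (t : ℝ≥0∞) ^ 2 * absNorm ρ (MvPolynomial.aeval (u + h) (MvPolynomial.monomial γ (1 : 𝕜)) -
        MvPolynomial.aeval (u + h') (MvPolynomial.monomial γ (1 : 𝕜)) -
        monomialLinearPart u (h - h') γ) ≤
      (γ.degree : ℝ≥0∞) ^ 2 * (D * M) * (t : ℝ≥0∞) ^ γ.degree := by
  induction γ using finsupp_induction_add_single with
  | zero => simp [monomialLinearPart]
  | add_single γ v ih =>
    have h1 := absNorm_aeval_monomial_sub_le (𝕜 := 𝕜) (a := u + h) (b := u + h') (D := D) huh huh'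
      (fun v => by simpa using hD v) γ
    have h2 := absNorm_aeval_monomial_sub_le (𝕜 := 𝕜) (a := u + h') (b := u) (D := M) huh' hu
      (fun v => by simpa using hM' v) γ
    rw [aeval_monomial_add_single, aeval_monomial_add_single, monomialLinearPart_add_single,
      map_add, Finsupp.degree_single, pow_succ (t : ℝ≥0∞)]
    set A := MvPolynomial.aeval (u + h) (MvPolynomial.monomial γ (1 : 𝕜))
    set B := MvPolynomial.aeval (u + h') (MvPolynomial.monomial γ (1 : 𝕜))
    set U := MvPolynomial.aeval u (MvPolynomial.monomial γ (1 : 𝕜))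
    set L := monomialLinearPart u (h - h') γ
    have e : A * (u + h) v - B * (u + h') v - (L * u v + U * (h - h') v) =
        (A - B - L) * u v + ((A - B) * h v + (B - U) * (h v - h' v)) := by
      simp only [Pi.add_apply, Pi.sub_apply]
      ring
    rw [e]
    calc (t : ℝ≥0∞) ^ 2 * absNorm ρ
          ((A - B - L) * u v + ((A - B) * h v + (B - U) * (h v - h' v)))
        ≤ (t : ℝ≥0∞) ^ 2 * (absNorm ρ (A - B - L) * absNorm ρ (u v) +
            (absNorm ρ (A - B) * absNorm ρ (h v) +
              absNorm ρ (B - U) * absNorm ρ (h v - h' v))) := by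
          gcongr
          refine (absNorm_add_le _ _ _).trans (add_le_add (absNorm_mul_le _ _ _)
            ((absNorm_add_le _ _ _).trans (add_le_add (absNorm_mul_le _ _ _)
            (absNorm_mul_le _ _ _))))
      _ ≤ (t : ℝ≥0∞) ^ 2 * (absNorm ρ (A - B - L) * t +
            (absNorm ρ (A - B) * M + absNorm ρ (B - U) * D)) := by
          gcongr
          · exact hu v
          · exact hM v
          · exact hD v
      _ = (t : ℝ≥0∞) ^ 2 * absNorm ρ (A - B - L) * t +
            (t * absNorm ρ (A - B) * M + t * absNorm ρ (B - U) * D) * t := by ring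
      _ ≤ (γ.degree : ℝ≥0∞) ^ 2 * (D * M) * (t : ℝ≥0∞) ^ γ.degree * t +
            (γ.degree * D * (t : ℝ≥0∞) ^ γ.degree * M +
              γ.degree * M * (t : ℝ≥0∞) ^ γ.degree * D) * t := by gcongr
      _ = ((γ.degree : ℝ≥0∞) ^ 2 + 2 * γ.degree) * (D * M) * ((t : ℝ≥0∞) ^ γ.degree * t) := by
          ring
      _ ≤ _ := by
          rw [pow_succ (t : ℝ≥0∞)]
          gcongr
          push_cast
          calc (γ.degree : ℝ≥0∞) ^ 2 + 2 * γ.degree ≤ (γ.degree : ℝ≥0∞) ^ 2 + 2 * γ.degree + 1 :=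
                le_self_add
            _ = _ := by ring

/-- First order Taylor formula for substitution, with a quadratic estimate of the remainder. -/
theorem absNorm_subst_remainder_le [Fintype σ] {ρ t : ℝ≥0} {D M : ℝ≥0∞}
    {u h h' : σ → MvPowerSeries τ 𝕜} (su : HasSubst u) (suh : HasSubst (u + h))
    (suh' : HasSubst (u + h')) (hu : ∀ v, absNorm ρ (u v) ≤ t)
    (huh : ∀ v, absNorm ρ (u v + h v) ≤ t) (huh' : ∀ v, absNorm ρ (u v + h' v) ≤ t)
    (hM : ∀ v, absNorm ρ (h v) ≤ M) (hM' : ∀ v, absNorm ρ (h' v) ≤ M)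
    (hD : ∀ v, absNorm ρ (h v - h' v) ≤ D) (f : MvPowerSeries σ 𝕜) :
    (t : ℝ≥0∞) ^ 2 * absNorm ρ (subst (u + h) f - subst (u + h') f -
        ∑ v, subst u (MvPowerSeries.pderiv 𝕜 v f) * (h v - h' v)) ≤
      D * M * absNorm (4 * t) f := by
  have key := ((isFormalSum_subst suh f).sub (isFormalSum_subst suh' f)).sub
    (IsFormalSum.sum Finset.univ fun v _ =>
      (isFormalSum_subst_pderiv su f v).mul_right (h v - h' v))
  have e : ∀ γ, coeff γ f • MvPolynomial.aeval (u + h) (MvPolynomial.monomial γ (1 : 𝕜)) -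
      coeff γ f • MvPolynomial.aeval (u + h') (MvPolynomial.monomial γ (1 : 𝕜)) -
      ∑ v, coeff γ f • MvPolynomial.aeval u (MvPolynomial.pderiv v
        (MvPolynomial.monomial γ (1 : 𝕜))) * (h v - h' v) =
      coeff γ f • (MvPolynomial.aeval (u + h) (MvPolynomial.monomial γ (1 : 𝕜)) -
        MvPolynomial.aeval (u + h') (MvPolynomial.monomial γ (1 : 𝕜)) -
        monomialLinearPart u (h - h') γ) := by
    intro γ
    simp only [monomialLinearPart, smul_sub, Finset.smul_sum, smul_mul_assoc, Pi.sub_apply]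
  simp_rw [e] at key
  refine (mul_le_mul_right (key.absNorm_le ρ) _).trans ?_
  calc
    _ ≤ ∑' γ : σ →₀ ℕ, D * M * (‖coeff γ f‖ₑ * ((4 * t : ℝ≥0) : ℝ≥0∞) ^ γ.degree) := by
      rw [← ENNReal.tsum_mul_left]
      refine ENNReal.tsum_le_tsum fun γ => ?_
      rw [absNorm_smul]
      -- The polynomial factor of the monomial estimate is absorbed by enlarging the radius from `t`
      -- to `4 * t`.
      have h4 : (γ.degree : ℝ≥0∞) ^ 2 ≤ 4 ^ γ.degree := by
        have : γ.degree ^ 2 ≤ 4 ^ γ.degree := by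
          rw [show 4 = 2 ^ 2 from rfl, ← pow_mul, mul_comm, pow_mul]
          exact Nat.pow_le_pow_left Nat.lt_two_pow_self.le 2
        exact_mod_cast this
      rw [mul_left_comm]
      refine (mul_le_mul_right (absNorm_aeval_monomial_remainder_le hu huh huh' hM hM' hD γ)
        _).trans ?_
      calc
        _ ≤ ‖coeff γ f‖ₑ * (4 ^ γ.degree * (D * M) * (t : ℝ≥0∞) ^ γ.degree) := by gcongr
        _ = _ := by
          rw [ENNReal.coe_mul, mul_pow]
          push_cast
          ring
    _ = _ := ENNReal.tsum_mul_left

end Subst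

/-! ### Homogeneous parts and the jet norm -/

section JetNorm

variable {𝕜 : Type*} [RCLike 𝕜] {n r s : ℕ}

theorem mem_finsuppAntidiag_univ_iff {α : Fin n →₀ ℕ} {l : ℕ} :
    α ∈ (Finset.univ : Finset (Fin n)).finsuppAntidiag l ↔ α.degree = l := by
  simp [Finset.mem_finsuppAntidiag, Finsupp.degree_eq_sum]

theorem tsum_eq_tsum_sum_degree (g : (Fin n →₀ ℕ) → ℝ≥0∞) :
    ∑' α, g α = ∑' l : ℕ, ∑ α ∈ (Finset.univ : Finset (Fin n)).finsuppAntidiag l, g α := by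
  rw [← (Equiv.sigmaFiberEquiv fun α : Fin n →₀ ℕ => α.degree).tsum_eq g, ENNReal.tsum_sigma']
  refine tsum_congr fun l => ?_
  have h : ∀ x : {α : Fin n →₀ ℕ // α.degree = l},
      g ((Equiv.sigmaFiberEquiv fun α : Fin n →₀ ℕ => α.degree) ⟨l, x⟩) = g x.1 := fun x => rfl
  simp_rw [h]
  rw [← Finset.tsum_subtype]
  exact (Equiv.subtypeEquivRight fun α => mem_finsuppAntidiag_univ_iff.symm).tsum_eq
    (fun x : {α // α ∈ (Finset.univ : Finset (Fin n)).finsuppAntidiag l} => g x.1)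

theorem homNorm_nonneg (l : ℕ) (f : MvPowerSeries (Fin n) 𝕜) : 0 ≤ homNorm l f :=
  Finset.sum_nonneg fun _ _ => norm_nonneg _

theorem ofReal_homNorm (l : ℕ) (f : MvPowerSeries (Fin n) 𝕜) :
    ENNReal.ofReal (homNorm l f) =
      ∑ α ∈ (Finset.univ : Finset (Fin n)).finsuppAntidiag l, ‖coeff α f‖ₑ := by
  rw [homNorm, ENNReal.ofReal_sum_of_nonneg fun _ _ => norm_nonneg _]
  simp_rw [ofReal_norm]

theorem absNorm_eq_tsum_homNorm (ρ : ℝ≥0) (f : MvPowerSeries (Fin n) 𝕜) :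
    absNorm ρ f = ∑' l, ENNReal.ofReal (homNorm l f) * (ρ : ℝ≥0∞) ^ l := by
  rw [absNorm, tsum_eq_tsum_sum_degree]
  refine tsum_congr fun l => ?_
  rw [ofReal_homNorm, Finset.sum_mul]
  refine Finset.sum_congr rfl fun α hα => ?_
  rw [mem_finsuppAntidiag_univ_iff.1 hα]

theorem le_order_iff_homNorm {p : ℕ} {f : MvPowerSeries (Fin n) 𝕜} :
    (p : ℕ∞) ≤ f.order ↔ ∀ l < p, homNorm l f = 0 := by
  constructor
  · intro h l hl
    refine Finset.sum_eq_zero fun α hα => ?_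
    rw [coeff_of_lt_order (lt_of_lt_of_le _ h), norm_zero]
    rw [mem_finsuppAntidiag_univ_iff.1 hα]
    exact_mod_cast hl
  · intro h
    refine nat_le_order fun α hα => ?_
    have := (Finset.sum_eq_zero_iff_of_nonneg fun _ _ => norm_nonneg _).1 (h _ hα) α
      (mem_finsuppAntidiag_univ_iff.2 rfl)
    exact norm_eq_zero.1 this

/-- The norm `∑ᵢ (|(z^q F̂ᵢ)^{(mᵢ)}|)(ρ)` controlled by the big denominators estimate. -/
def jetNorm (m : Fin r → ℕ) (q : ℕ) (ρ : ℝ≥0) (F : Fin r → MvPowerSeries (Fin n) 𝕜) : ℝ≥0∞ :=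
  ∑ i, ∑' β : Fin n →₀ ℕ, ((β.degree + q).descFactorial (m i) : ℝ≥0∞) * ‖coeff β (F i)‖ₑ *
    (ρ : ℝ≥0∞) ^ (β.degree + q - m i)

variable {m : Fin r → ℕ} {q : ℕ}

@[simp]
theorem jetNorm_zero (ρ : ℝ≥0) : jetNorm m q ρ (0 : Fin r → MvPowerSeries (Fin n) 𝕜) = 0 := by
  simp [jetNorm]

theorem jetNorm_add_le (ρ : ℝ≥0) (F G : Fin r → MvPowerSeries (Fin n) 𝕜) :
    jetNorm m q ρ (F + G) ≤ jetNorm m q ρ F + jetNorm m q ρ G := by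
  rw [jetNorm, jetNorm, jetNorm, ← Finset.sum_add_distrib]
  refine Finset.sum_le_sum fun i _ => ?_
  rw [← ENNReal.tsum_add]
  refine ENNReal.tsum_le_tsum fun β => ?_
  rw [← add_mul, ← mul_add, Pi.add_apply, map_add]
  gcongr
  exact enorm_add_le _ _

/-- The jet norm of a map of filtered order at least `k` is `O(ρ^(k+q))`. -/
theorem jetNorm_mul_pow_le {ρ ρ' : ℝ≥0} (h : ρ ≤ ρ') {F : Fin r → MvPowerSeries (Fin n) 𝕜}
    {k : ℕ} (hF : ∀ i, ((m i + k : ℕ) : ℕ∞) ≤ (F i).order) :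
    jetNorm m q ρ F * (ρ' : ℝ≥0∞) ^ (k + q) ≤ (ρ : ℝ≥0∞) ^ (k + q) * jetNorm m q ρ' F := by
  rw [jetNorm, jetNorm, Finset.sum_mul, Finset.mul_sum]
  refine Finset.sum_le_sum fun i _ => ?_
  rw [← ENNReal.tsum_mul_right, ← ENNReal.tsum_mul_left]
  refine ENNReal.tsum_le_tsum fun β => ?_
  by_cases hβ : β.degree < m i + k
  · rw [coeff_of_lt_order (lt_of_lt_of_le (by exact_mod_cast hβ) (hF i))]
    simp
  · obtain ⟨d, hd⟩ := Nat.exists_eq_add_of_le (not_lt.1 hβ)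
    have h' : (ρ : ℝ≥0∞) ≤ ρ' := by exact_mod_cast h
    have hexp : β.degree + q - m i = (k + q) + d := by omega
    rw [hexp, pow_add _ (k + q) d, pow_add _ (k + q) d]
    set A := ((β.degree + q).descFactorial (m i) : ℝ≥0∞) * ‖coeff β (F i)‖ₑ
    calc A * ((ρ : ℝ≥0∞) ^ (k + q) * (ρ : ℝ≥0∞) ^ d) * (ρ' : ℝ≥0∞) ^ (k + q)
        ≤ A * ((ρ : ℝ≥0∞) ^ (k + q) * (ρ' : ℝ≥0∞) ^ d) * (ρ' : ℝ≥0∞) ^ (k + q) := by gcongr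
      _ = _ := by ring

/-! ### Descending factorials and control of partial derivatives by the jet norm -/

theorem descFactorial_mul_descFactorial_le (a b c d : ℕ) :
    a.descFactorial b * c.descFactorial d ≤ (a + c).descFactorial (b + d) := by
  by_cases hb : b ≤ a
  · rw [← Nat.descFactorial_mul_descFactorial (Nat.le_add_right b d), mul_comm,
      Nat.add_sub_cancel_left]
    exact Nat.mul_le_mul (Nat.descFactorial_le d (by omega))
      (Nat.descFactorial_le b (Nat.le_add_right a c))
  · rw [Nat.descFactorial_eq_zero_iff_lt.2 (not_le.1 hb), zero_mul]
    exact Nat.zero_le _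

theorem prod_descFactorial_le {ι : Type*} (t : Finset ι) (a b : ι → ℕ) :
    ∏ i ∈ t, (a i).descFactorial (b i) ≤ (∑ i ∈ t, a i).descFactorial (∑ i ∈ t, b i) := by
  classical
  induction t using Finset.induction_on with
  | empty => simp
  | insert i t hi ih =>
    rw [Finset.prod_insert hi, Finset.sum_insert hi, Finset.sum_insert hi]
    exact (Nat.mul_le_mul_left _ ih).trans (descFactorial_mul_descFactorial_le _ _ _ _)

/-- The extra factor `(L + q - a).descFactorial (k - a)` is a positive integer because `k ≤ L`. -/
theorem descFactorial_le_descFactorial_add {L a k : ℕ} (q : ℕ) (hak : a ≤ k) (hk : k ≤ L) :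
    L.descFactorial a ≤ (L + q).descFactorial k := by
  rw [← Nat.descFactorial_mul_descFactorial hak]
  calc L.descFactorial a ≤ (L + q).descFactorial a := Nat.descFactorial_le a (by omega)
    _ ≤ _ := Nat.le_mul_of_pos_left _ (Nat.pos_of_ne_zero fun h0 => by
      rw [Nat.descFactorial_eq_zero_iff_lt] at h0
      omega)

theorem coeff_partialDeriv (α β : Fin n →₀ ℕ) (f : MvPowerSeries (Fin n) 𝕜) :
    coeff β (partialDeriv α f) =
      ((∏ i, (β i + α i).descFactorial (α i) : ℕ) : 𝕜) * coeff (β + α) f :=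
  rfl

theorem partialDeriv_add (α : Fin n →₀ ℕ) (f g : MvPowerSeries (Fin n) 𝕜) :
    partialDeriv α (f + g) = partialDeriv α f + partialDeriv α g := by
  ext β
  simp only [map_add, coeff_partialDeriv, mul_add]

theorem partialDeriv_sub (α : Fin n →₀ ℕ) (f g : MvPowerSeries (Fin n) 𝕜) :
    partialDeriv α (f - g) = partialDeriv α f - partialDeriv α g := by
  ext β
  simp only [map_sub, coeff_partialDeriv, mul_sub]

/-- The numerical factor produced by `∂^α` is at most `(|α| + |β| + q).descFactorial (m i)`, the
weight in the jet norm; comparing powers of `ρ` then gives the exponents `q` and `m i - |α|`. -/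
theorem pow_mul_absNorm_partialDeriv_le (ρ : ℝ≥0) {F : Fin r → MvPowerSeries (Fin n) 𝕜}
    (hF : F ∈ FormalMaps 𝕜 n m 0) (i : Fin r) {α : Fin n →₀ ℕ} (hα : α.degree ≤ m i) :
    (ρ : ℝ≥0∞) ^ q * absNorm ρ (partialDeriv α (F i)) ≤
      (ρ : ℝ≥0∞) ^ (m i - α.degree) * jetNorm m q ρ F := by
  set g : (Fin n →₀ ℕ) → ℝ≥0∞ := fun β => ((β.degree + q).descFactorial (m i) : ℝ≥0∞) *
    ‖coeff β (F i)‖ₑ * (ρ : ℝ≥0∞) ^ (β.degree + q - m i) with hg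
  have h1 : ∑' β, g (β + α) ≤ jetNorm m q ρ F :=
    (ENNReal.tsum_comp_le_tsum_of_injective (add_left_injective α) g).trans
      (Finset.single_le_sum (f := fun i => ∑' β : Fin n →₀ ℕ,
        ((β.degree + q).descFactorial (m i) : ℝ≥0∞) * ‖coeff β (F i)‖ₑ *
        (ρ : ℝ≥0∞) ^ (β.degree + q - m i)) (fun _ _ => zero_le) (Finset.mem_univ i))
  refine le_trans ?_ (mul_le_mul_right h1 _)
  rw [absNorm, ← ENNReal.tsum_mul_left, ← ENNReal.tsum_mul_left]
  refine ENNReal.tsum_le_tsum fun β => ?_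
  rw [coeff_partialDeriv, enorm_mul, hg]
  -- Coefficients of degree at most `m i` vanish; beyond them the natural number subtractions are
  -- exact and the weight is nonzero.
  by_cases hβ : (β + α).degree < m i + 1
  · rw [coeff_of_lt_order (lt_of_lt_of_le (by exact_mod_cast hβ) (hF i))]
    simp
  · have hdeg : (β + α).degree = β.degree + α.degree := map_add _ _ _
    have hnat : ∏ i, (β i + α i).descFactorial (α i) ≤
        ((β + α).degree + q).descFactorial (m i) := by
      refine (prod_descFactorial_le _ _ _).trans ?_
      have := descFactorial_le_descFactorial_add q hα (by omega : m i ≤ (β + α).degree)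
      rw [Finsupp.degree_eq_sum, Finsupp.degree_eq_sum] at this
      rw [Finsupp.degree_eq_sum]
      exact this
    have hcoef : ‖((∏ i, (β i + α i).descFactorial (α i) : ℕ) : 𝕜)‖ₑ ≤
        (((β + α).degree + q).descFactorial (m i) : ℝ≥0∞) := by
      rw [enorm_eq_nnnorm, RCLike.nnnorm_natCast]
      exact_mod_cast hnat
    have hexp : q + β.degree = (m i - α.degree) + ((β + α).degree + q - m i) := by omega
    calc _ = ‖((∏ i, (β i + α i).descFactorial (α i) : ℕ) : 𝕜)‖ₑ * ‖coeff (β + α) (F i)‖ₑ *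
          (ρ : ℝ≥0∞) ^ (q + β.degree) := by rw [pow_add]; ring
      _ ≤ (((β + α).degree + q).descFactorial (m i) : ℝ≥0∞) * ‖coeff (β + α) (F i)‖ₑ *
          (ρ : ℝ≥0∞) ^ (q + β.degree) := by gcongr
      _ = _ := by rw [hexp, pow_add]; ring

/-! ### Consequences of the majorant estimate -/

/-- This is the majorant inequality at `z^p`: the monomial of degree `l` moves to degree `l + q`,
then down by `k` under differentiation. -/
theorem descFactorial_mul_homNorm_le {k : ℕ} {C : ℝ} {f : MvPowerSeries (Fin n) 𝕜}
    {G : Fin s → MvPowerSeries (Fin n) 𝕜}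
    (h : Dominated ((PowerSeries.derivative ℝ)^[k] (PowerSeries.X ^ q * hat (fun _ : Fin 1 => f)))
      (C • hat G)) {l p : ℕ} (hlp : l + q = p + k) :
    ((l + q).descFactorial k : ℝ) * homNorm l f ≤ C * ⨆ j, homNorm p (G j) := by
  have h1 := (le_abs_self _).trans (h p).2
  rw [PowerSeries.coeff_iterate_derivative, ← Nat.add_descFactorial_eq_ascFactorial, ← hlp,
    PowerSeries.coeff_X_pow_mul] at h1
  simpa [hat] using h1

/-- In degrees `l > k` the big denominator is positive, so the homogeneous part of `f` vanishes
together with the part of `G` of degree `l + q - k`. -/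
theorem le_order_of_dominated {k d : ℕ} {C : ℝ} {f : MvPowerSeries (Fin n) 𝕜}
    {G : Fin s → MvPowerSeries (Fin n) 𝕜} (hf : ((k + 1 : ℕ) : ℕ∞) ≤ f.order)
    (h : Dominated ((PowerSeries.derivative ℝ)^[k] (PowerSeries.X ^ q * hat (fun _ : Fin 1 => f)))
      (C • hat G)) (hG : ((d + q : ℕ) : ℕ∞) ≤ tupleOrder G) :
    ((k + d : ℕ) : ℕ∞) ≤ f.order := by
  rw [le_order_iff_homNorm] at hf ⊢
  intro l hl
  by_cases hlk : l < k + 1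
  · exact hf l hlk
  · obtain ⟨p, hp⟩ : ∃ p, l + q = p + k := ⟨l + q - k, by omega⟩
    have h1 := descFactorial_mul_homNorm_le h hp
    have h2 : ∀ j, homNorm p (G j) = 0 := fun j =>
      le_order_iff_homNorm.1 (hG.trans (iInf_le _ j)) p (by omega)
    simp only [h2, Real.iSup_const_zero, mul_zero] at h1
    have h3 : (0 : ℝ) < ((l + q).descFactorial k : ℝ) := by
      exact_mod_cast Nat.pos_of_ne_zero fun h0 => by
        rw [Nat.descFactorial_eq_zero_iff_lt] at h0
        omega
    exact le_antisymm (nonpos_of_mul_nonpos_right h1 h3) (homNorm_nonneg _ _)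

/-- Sum the coefficient inequalities against powers of `ρ`. Bounding maxima over components by sums
costs only the factor `r` and constants independent of `ρ`. -/
theorem jetNorm_le_of_dominated (ρ : ℝ≥0) {C : ℝ} (hC : 0 ≤ C)
    {F : Fin r → MvPowerSeries (Fin n) 𝕜}
    {G : Fin s → MvPowerSeries (Fin n) 𝕜} (hF : F ∈ FormalMaps 𝕜 n m 0)
    (h : ∀ i, Dominated ((PowerSeries.derivative ℝ)^[m i]
      (PowerSeries.X ^ q * hat (fun _ : Fin 1 => F i))) (C • hat G)) :
    jetNorm m q ρ F ≤ r * ENNReal.ofReal C * ∑ j, absNorm ρ (G j) := by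
  have key : ∀ i, ∑' β : Fin n →₀ ℕ, ((β.degree + q).descFactorial (m i) : ℝ≥0∞) *
      ‖coeff β (F i)‖ₑ * (ρ : ℝ≥0∞) ^ (β.degree + q - m i) ≤
      ENNReal.ofReal C * ∑ j, absNorm ρ (G j) := by
    intro i
    set φ : ℕ → ℝ≥0∞ := fun p =>
      ENNReal.ofReal C * ∑ j, ENNReal.ofReal (homNorm p (G j)) * (ρ : ℝ≥0∞) ^ p with hφ
    have hφsum : ENNReal.ofReal C * ∑ j, absNorm ρ (G j) = ∑' p, φ p := by
      simp_rw [absNorm_eq_tsum_homNorm]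
      rw [hφ, ENNReal.tsum_mul_left, Summable.tsum_finsetSum fun _ _ => ENNReal.summable]
    rw [hφsum, tsum_eq_tsum_sum_degree]
    have hl : ∀ l, ∑ β ∈ (Finset.univ : Finset (Fin n)).finsuppAntidiag l,
        ((β.degree + q).descFactorial (m i) : ℝ≥0∞) * ‖coeff β (F i)‖ₑ *
          (ρ : ℝ≥0∞) ^ (β.degree + q - m i) =
        ((l + q).descFactorial (m i) : ℝ≥0∞) * ENNReal.ofReal (homNorm l (F i)) *
          (ρ : ℝ≥0∞) ^ (l + q - m i) := by
      intro l
      rw [ofReal_homNorm, Finset.mul_sum, Finset.sum_mul]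
      refine Finset.sum_congr rfl fun β hβ => ?_
      rw [mem_finsuppAntidiag_univ_iff.1 hβ]
    simp_rw [hl]
    have hle : ∀ l, m i ≤ l → ((l + q).descFactorial (m i) : ℝ≥0∞) *
        ENNReal.ofReal (homNorm l (F i)) * (ρ : ℝ≥0∞) ^ (l + q - m i) ≤ φ (l + q - m i) := by
      intro l hml
      have h1 := descFactorial_mul_homNorm_le (h i)
        (show l + q = (l + q - m i) + m i by omega)
      rw [hφ]
      simp only
      rw [← Finset.sum_mul, ← mul_assoc]
      refine mul_le_mul_left ?_ _
      rw [← ENNReal.ofReal_natCast, ← ENNReal.ofReal_mul (Nat.cast_nonneg _),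
        ← ENNReal.ofReal_sum_of_nonneg fun _ _ => homNorm_nonneg _ _, ← ENNReal.ofReal_mul hC]
      refine ENNReal.ofReal_le_ofReal (h1.trans ?_)
      gcongr
      refine Real.iSup_le (fun j => ?_) (Finset.sum_nonneg fun _ _ => homNorm_nonneg _ _)
      exact Finset.single_le_sum (f := fun j => homNorm (l + q - m i) (G j))
        (fun _ _ => homNorm_nonneg _ _) (Finset.mem_univ j)
    have hzero : ∀ l, l < m i → ((l + q).descFactorial (m i) : ℝ≥0∞) *
        ENNReal.ofReal (homNorm l (F i)) * (ρ : ℝ≥0∞) ^ (l + q - m i) = 0 := by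
      intro l hml
      rw [le_order_iff_homNorm.1 (hF i) l (by omega)]
      simp
    -- The shift `l ↦ l + q - m i` is injective only where the subtraction does not truncate, hence
    -- the restriction to `m i ≤ l`.
    rw [← tsum_subtype_eq_of_support_subset (s := {l | m i ≤ l})
      (fun l hl' => not_lt.1 fun hlt => hl' (hzero l hlt))]
    refine (ENNReal.tsum_le_tsum fun l : {l | m i ≤ l} => hle l.1 l.2).trans ?_
    refine ENNReal.tsum_comp_le_tsum_of_injective (f := fun l : {l | m i ≤ l} => l.1 + q - m i)
      (fun a b hab => Subtype.ext ?_) φ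
    have ha : m i ≤ a.1 := a.2
    have hb : m i ≤ b.1 := b.2
    simp only at hab
    omega
  calc jetNorm m q ρ F ≤ ∑ _i : Fin r, ENNReal.ofReal C * ∑ j, absNorm ρ (G j) :=
        Finset.sum_le_sum fun i _ => key i
    _ = _ := by simp [mul_assoc]

end JetNorm

/-! ### Small radii -/

section SmallRadius

variable {𝕜 : Type*} [RCLike 𝕜] {n r s : ℕ} {σ τ : Type*}

theorem le_inv_mul_of_mul_le {a b c : ℝ≥0∞} (h0 : a ≠ 0) (ht : a ≠ ∞) (h : a * b ≤ c) :
    b ≤ a⁻¹ * c := by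
  rw [mul_comm, ← div_eq_mul_inv, ENNReal.le_div_iff_mul_le (Or.inl h0) (Or.inl ht), mul_comm]
  exact h

theorem eventually_radius_le {ε : ℝ≥0} (hε : 0 < ε) : ∀ᶠ ρ : ℝ≥0 in 𝓝[>] (0 : ℝ≥0), ρ ≤ ε :=
  mem_of_superset (Ioo_mem_nhdsGT hε) fun _ h => h.2.le

theorem eventually_mul_pow_le {K ε : ℝ≥0∞} (hK : K ≠ ∞) (hε : 0 < ε) (p : ℕ) :
    ∀ᶠ ρ : ℝ≥0 in 𝓝[>] (0 : ℝ≥0), K * (ρ : ℝ≥0∞) ^ (p + 1) ≤ ε := by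
  have h1 : Tendsto (fun ρ : ℝ≥0 => K * (ρ : ℝ≥0∞)) (𝓝 0) (𝓝 (K * (0 : ℝ≥0))) :=
    ENNReal.Tendsto.const_mul (ENNReal.tendsto_coe.2 tendsto_id) (Or.inr hK)
  rw [ENNReal.coe_zero, mul_zero] at h1
  filter_upwards [(h1.mono_left nhdsWithin_le_nhds).eventually (gt_mem_nhds hε),
    eventually_radius_le one_pos] with ρ h2 h3
  refine le_trans ?_ h2.le
  gcongr
  rw [pow_succ]
  exact mul_le_of_le_one_left' (pow_le_one' (by exact_mod_cast h3) _)

theorem IsConvergent.eventually_absNorm_ne_top [Finite σ] {f : MvPowerSeries σ 𝕜}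
    (hf : IsConvergent f) : ∀ᶠ ρ : ℝ≥0 in 𝓝[>] (0 : ℝ≥0), absNorm ρ f ≠ ∞ := by
  obtain ⟨ρ₀, h₀, h⟩ := hf.exists_absNorm_ne_top
  filter_upwards [eventually_radius_le h₀] with ρ hρ
  exact ne_top_of_le_ne_top h (absNorm_mono hρ f)

/-- A convergent power series of order at least `p` is `O(ρ^p)` on small polydiscs. -/
theorem IsConvergent.exists_absNorm_le [Finite σ] {f : MvPowerSeries σ 𝕜}
    (hf : IsConvergent f) {p : ℕ} (hp : (p : ℕ∞) ≤ f.order) :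
    ∃ K : ℝ≥0∞, K ≠ ∞ ∧ ∀ᶠ ρ : ℝ≥0 in 𝓝[>] (0 : ℝ≥0), absNorm ρ f ≤ K * (ρ : ℝ≥0∞) ^ p := by
  obtain ⟨ρ₀, h₀, h⟩ := hf.exists_absNorm_ne_top
  have hne : (ρ₀ : ℝ≥0∞) ^ p ≠ 0 := pow_ne_zero _ (by exact_mod_cast h₀.ne')
  have hnt : (ρ₀ : ℝ≥0∞) ^ p ≠ ∞ := ENNReal.pow_ne_top ENNReal.coe_ne_top
  refine ⟨absNorm ρ₀ f / (ρ₀ : ℝ≥0∞) ^ p, ENNReal.div_ne_top h hne, ?_⟩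
  filter_upwards [eventually_radius_le h₀] with ρ hρ
  have h1 := absNorm_mul_pow_le hρ hp
  rw [← ENNReal.mul_div_right_comm, ENNReal.le_div_iff_mul_le (Or.inl hne) (Or.inl hnt),
    mul_comm _ ((ρ : ℝ≥0∞) ^ p)]
  exact h1

theorem isConvergent_of_absNorm_ne_top {ρ : ℝ≥0} (hρ : 0 < ρ) {f : MvPowerSeries σ 𝕜}
    (h : absNorm ρ f ≠ ∞) : IsConvergent f :=
  isConvergent_of_coeff_mul_pow_le hρ h (coeff_le_absNorm ρ f)

theorem eventually_absNorm_family_le [Finite σ] [Finite τ] {a : σ → MvPowerSeries τ 𝕜}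
    (ha : ∀ v, IsConvergent (a v)) (h0 : ∀ v, constantCoeff (a v) = 0) {t : ℝ≥0∞}
    (ht : 0 < t) : ∀ᶠ ρ : ℝ≥0 in 𝓝[>] (0 : ℝ≥0), ∀ v, absNorm ρ (a v) ≤ t := by
  rw [eventually_all]
  intro v
  obtain ⟨K, hK, h⟩ := (ha v).exists_absNorm_le (p := 1)
    (by simpa using one_le_order_iff_constCoeff_eq_zero.2 (h0 v))
  filter_upwards [h, eventually_mul_pow_le hK ht 0] with ρ h1 h2
  exact h1.trans h2

theorem IsConvergent.subst [Finite σ] [Finite τ] {f : MvPowerSeries σ 𝕜} (hf : IsConvergent f)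
    {a : σ → MvPowerSeries τ 𝕜} (ha : ∀ v, IsConvergent (a v))
    (h0 : ∀ v, constantCoeff (a v) = 0) : IsConvergent (MvPowerSeries.subst a f) := by
  obtain ⟨t, ht, hft⟩ := hf.exists_absNorm_ne_top
  obtain ⟨ρ, h1, h2⟩ := ((eventually_absNorm_family_le ha h0
    (by exact_mod_cast ht : (0 : ℝ≥0∞) < t)).and self_mem_nhdsWithin).exists
  exact isConvergent_of_absNorm_ne_top h2 (ne_top_of_le_ne_top hft
    (absNorm_subst_le (hasSubst_of_constantCoeff_zero h0) h1 f))

theorem isConvergent_X (i : σ) : IsConvergent (X i : MvPowerSeries σ 𝕜) := by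
  classical
  refine ⟨1, 1, one_pos, one_pos, fun α => ?_⟩
  rw [coeff_X]
  split_ifs <;> simp

theorem IsConvergent.partialDeriv {f : MvPowerSeries (Fin n) 𝕜} (hf : IsConvergent f)
    (α : Fin n →₀ ℕ) : IsConvergent (partialDeriv α f) := by
  obtain ⟨M, R, hM, hR, h⟩ := hf
  refine ⟨(α.degree.factorial * 2 ^ α.degree) * (M * R ^ α.degree), 2 * R, by positivity,
    by positivity, fun β => ?_⟩
  rw [coeff_partialDeriv, norm_mul, RCLike.norm_natCast]
  have h1 : ∏ i, (β i + α i).descFactorial (α i) ≤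
      α.degree.factorial * 2 ^ (β.degree + α.degree) := by
    refine (prod_descFactorial_le _ _ _).trans ?_
    rw [← Finsupp.degree_eq_sum, Nat.descFactorial_eq_factorial_mul_choose,
      Finset.sum_add_distrib, ← Finsupp.degree_eq_sum, ← Finsupp.degree_eq_sum]
    exact Nat.mul_le_mul_left _ (Nat.choose_le_two_pow _ _)
  calc _ ≤ ((α.degree.factorial * 2 ^ (β.degree + α.degree) : ℕ) : ℝ) *
        (M * R ^ (β + α).degree) := by
        gcongr
        exact h _
    _ = _ := by
      rw [map_add]
      push_cast
      ring

end SmallRadius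

/-! ### Contraction property of regular differential maps -/

section Contraction

variable {𝕜 : Type*} [RCLike 𝕜] {n r s : ℕ} {m : Fin r → ℕ} {q : ℕ}

theorem constantCoeff_jet {F : Fin r → MvPowerSeries (Fin n) 𝕜} (hF : F ∈ FormalMaps 𝕜 n m 0)
    (v : JetCoord n m) : constantCoeff (jet m F v) = 0 := by
  rcases v with i | ⟨j, α, hα⟩
  · simp [jet]
  · have h : coeff α (F j) = 0 := by
      apply coeff_of_lt_order
      refine lt_of_lt_of_le ?_ (hF j)
      exact_mod_cast Nat.lt_succ_of_le hα
    change ((∏ i, ((0 : Fin n →₀ ℕ) i + α i).descFactorial (α i) : ℕ) : 𝕜) *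
      coeff (0 + α) (F j) = 0
    rw [zero_add, h, mul_zero]

theorem isConvergent_jet {F : Fin r → MvPowerSeries (Fin n) 𝕜} (hF : F ∈ AnalyticGerms 𝕜 n r)
    (v : JetCoord n m) : IsConvergent (jet m F v) := by
  rcases v with i | ⟨j, α, hα⟩
  · exact isConvergent_X i
  · exact (hF j).partialDeriv α

/-- The variation of the jet under the variation `H` of a map. -/
def jetVariation (m : Fin r → ℕ) (H : Fin r → MvPowerSeries (Fin n) 𝕜) :
    JetCoord n m → MvPowerSeries (Fin n) 𝕜 :=
  Sum.elim (fun _ => 0) (fun v => partialDeriv v.2.1 (H v.1))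

theorem jet_add (F H : Fin r → MvPowerSeries (Fin n) 𝕜) :
    jet m (F + H) = jet m F + jetVariation m H := by
  funext v
  rcases v with i | v
  · simp [jet, jetVariation]
  · simp [jet, jetVariation, partialDeriv_add]

theorem jetVariation_sub (H H' : Fin r → MvPowerSeries (Fin n) 𝕜) (v : JetCoord n m) :
    jetVariation m H v - jetVariation m H' v = jetVariation m (H - H') v := by
  rcases v with i | v
  · simp [jetVariation]
  · simp [jetVariation, partialDeriv_sub]

theorem pow_mul_absNorm_jetVariation_le {ρ : ℝ≥0} (hρ : ρ ≤ 1)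
    {H : Fin r → MvPowerSeries (Fin n) 𝕜} (hH : H ∈ FormalMaps 𝕜 n m 0) (v : JetCoord n m) :
    (ρ : ℝ≥0∞) ^ q * absNorm ρ (jetVariation m H v) ≤ jetNorm m q ρ H := by
  rcases v with i | v
  · simp [jetVariation]
  · refine (pow_mul_absNorm_partialDeriv_le ρ hH v.1 v.2.2).trans ?_
    exact mul_le_of_le_one_left' (pow_le_one' (by exact_mod_cast hρ) _)

/-- The regularity exponent plus the gain `m - |α|` is at least `q + 1`: it pays for the loss
`ρ^(-q)` and leaves the factor `ρ` that drives the contraction. -/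
theorem pow_mul_absNorm_partialDeriv_le_mul_jetNorm {ρ : ℝ≥0} (h0 : 0 < ρ) (hρ : ρ ≤ 1)
    {H : Fin r → MvPowerSeries (Fin n) 𝕜} (hH : H ∈ FormalMaps 𝕜 n m 0) (v : JetIndex n m) :
    (ρ : ℝ≥0∞) ^ (v.2.1.degree + q + 1 - m v.1) * absNorm ρ (partialDeriv v.2.1 (H v.1)) ≤
      ρ * jetNorm m q ρ H := by
  have hne : (ρ : ℝ≥0∞) ^ q ≠ 0 := pow_ne_zero _ (by exact_mod_cast h0.ne')
  have hnt : (ρ : ℝ≥0∞) ^ q ≠ ∞ := ENNReal.pow_ne_top ENNReal.coe_ne_top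
  rw [← ENNReal.mul_le_mul_iff_right hne hnt]
  have hα := v.2.2
  calc _ = (ρ : ℝ≥0∞) ^ (v.2.1.degree + q + 1 - m v.1) *
        ((ρ : ℝ≥0∞) ^ q * absNorm ρ (partialDeriv v.2.1 (H v.1))) := by ring
    _ ≤ (ρ : ℝ≥0∞) ^ (v.2.1.degree + q + 1 - m v.1) *
        ((ρ : ℝ≥0∞) ^ (m v.1 - v.2.1.degree) * jetNorm m q ρ H) := by
      exact mul_le_mul_right (pow_mul_absNorm_partialDeriv_le ρ hH v.1 hα) _
    _ = (ρ : ℝ≥0∞) ^ ((v.2.1.degree + q + 1 - m v.1) + (m v.1 - v.2.1.degree)) *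
        jetNorm m q ρ H := by rw [pow_add]; ring
    _ ≤ (ρ : ℝ≥0∞) ^ (q + 1) * jetNorm m q ρ H := by
      refine mul_le_mul_left (pow_le_pow_right_of_le_one' (by exact_mod_cast hρ) (by omega)) _
    _ = _ := by ring

/-- Taylor expansion at the jet of `F`: regularity handles the linear part, while the ball of radius
`B * ρ^(2q+1)` handles the remainder. Regularity is needed only at the centre `F`. -/
theorem exists_absNorm_subst_jet_sub_le {f : MvPowerSeries (JetCoord n m) 𝕜}
    (hf : IsConvergent f) {F : Fin r → MvPowerSeries (Fin n) 𝕜} (hF : F ∈ AnalyticMaps 𝕜 n m 0)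
    (hreg : ∀ v : JetIndex n m, ((v.2.1.degree + q + 1 - m v.1 : ℕ) : ℕ∞) ≤
      (subst (jet m F) (pderiv 𝕜 (Sum.inr v) f)).order) {B : ℝ≥0∞} (hB : B ≠ ∞) :
    ∃ c : ℝ≥0∞, c ≠ ∞ ∧ ∀ᶠ ρ : ℝ≥0 in 𝓝[>] (0 : ℝ≥0),
      ∀ H ∈ FormalMaps 𝕜 n m 0, ∀ H' ∈ FormalMaps 𝕜 n m 0,
        jetNorm m q ρ H ≤ B * (ρ : ℝ≥0∞) ^ (2 * q + 1) →
        jetNorm m q ρ H' ≤ B * (ρ : ℝ≥0∞) ^ (2 * q + 1) →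
        absNorm ρ (subst (jet m (F + H)) f - subst (jet m (F + H')) f) ≤
          c * ρ * jetNorm m q ρ (H - H') := by
  classical
  cases nonempty_fintype (JetIndex n m)
  obtain ⟨t₀, ht₀, hft₀⟩ := hf.exists_absNorm_ne_top
  -- The remainder estimate involves `f` on radius `4 * t`. Below, half of `t` is allotted to the
  -- central jet and half to its variation.
  set t : ℝ≥0 := t₀ / 4 with ht
  have htpos : 0 < t := by positivity
  have h4t : 4 * t = t₀ := by rw [ht]; field_simp
  have hu0 : ∀ v, constantCoeff (jet m F v) = 0 := constantCoeff_jet hF.2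
  have huc : ∀ v, IsConvergent (jet m F v) := isConvergent_jet hF.1
  have hA : ∀ v : JetIndex n m, ∃ K : ℝ≥0∞, K ≠ ∞ ∧ ∀ᶠ ρ : ℝ≥0 in 𝓝[>] (0 : ℝ≥0),
      absNorm ρ (subst (jet m F) (pderiv 𝕜 (Sum.inr v) f)) ≤
        K * (ρ : ℝ≥0∞) ^ (v.2.1.degree + q + 1 - m v.1) := fun v =>
    ((hf.pderiv (Sum.inr v)).subst huc hu0).exists_absNorm_le (hreg v)
  choose K hK hKe using hA
  have ht2 : ((t / 2 : ℝ≥0) : ℝ≥0∞) + ((t / 2 : ℝ≥0) : ℝ≥0∞) = t := by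
    rw [← ENNReal.coe_add, add_halves]
  have ht2pos : (0 : ℝ≥0∞) < ((t / 2 : ℝ≥0) : ℝ≥0∞) := by
    exact_mod_cast (by positivity : 0 < t / 2)
  have htne : (t : ℝ≥0∞) ^ 2 ≠ 0 := pow_ne_zero _ (by exact_mod_cast htpos.ne')
  have htnt : (t : ℝ≥0∞) ^ 2 ≠ ∞ := ENNReal.pow_ne_top ENNReal.coe_ne_top
  refine ⟨((t : ℝ≥0∞) ^ 2)⁻¹ * (B * absNorm t₀ f) + ∑ v, K v, ?_, ?_⟩
  · refine ENNReal.add_ne_top.2 ⟨ENNReal.mul_ne_top (ENNReal.inv_ne_top.2 htne)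
      (ENNReal.mul_ne_top hB hft₀), ENNReal.sum_ne_top.2 fun v _ => hK v⟩
  filter_upwards [eventually_all.2 hKe, eventually_absNorm_family_le huc hu0 ht2pos,
    eventually_mul_pow_le hB ht2pos q, self_mem_nhdsWithin, eventually_radius_le one_pos]
    with ρ hKρ huρ hBρ hρ0 hρ1 H hH H' hH' hHB hHB'
  have hρne : (ρ : ℝ≥0∞) ^ q ≠ 0 := pow_ne_zero _ (by exact_mod_cast (ne_of_gt hρ0))
  have hρnt : (ρ : ℝ≥0∞) ^ q ≠ ∞ := ENNReal.pow_ne_top ENNReal.coe_ne_top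
  have hvar : ∀ G ∈ FormalMaps 𝕜 n m 0, jetNorm m q ρ G ≤ B * (ρ : ℝ≥0∞) ^ (2 * q + 1) →
      ∀ v, absNorm ρ (jetVariation m G v) ≤ B * (ρ : ℝ≥0∞) ^ (q + 1) := by
    intro G hG hGB v
    rw [← ENNReal.mul_le_mul_iff_right hρne hρnt]
    refine ((pow_mul_absNorm_jetVariation_le hρ1 hG v).trans hGB).trans (le_of_eq ?_)
    ring
  have hsum : ∀ G ∈ FormalMaps 𝕜 n m 0, jetNorm m q ρ G ≤ B * (ρ : ℝ≥0∞) ^ (2 * q + 1) →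
      ∀ v, absNorm ρ (jet m F v + jetVariation m G v) ≤ t := by
    intro G hG hGB v
    rw [← ht2]
    exact (absNorm_add_le _ _ _).trans (add_le_add ((huρ v)) ((hvar G hG hGB v).trans hBρ))
  have hsubst : ∀ G ∈ FormalMaps 𝕜 n m 0, HasSubst (jet m F + jetVariation m G) := by
    intro G hG
    rw [← jet_add]
    exact hasSubst_jet ((FormalMaps 𝕜 n m 0).add_mem hF.2 hG)
  have hD : ∀ v, absNorm ρ (jetVariation m H v - jetVariation m H' v) ≤
      ((ρ : ℝ≥0∞) ^ q)⁻¹ * jetNorm m q ρ (H - H') := by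
    intro v
    rw [jetVariation_sub]
    refine le_inv_mul_of_mul_le hρne hρnt ?_
    exact pow_mul_absNorm_jetVariation_le hρ1 ((FormalMaps 𝕜 n m 0).sub_mem hH hH') v
  have key := absNorm_subst_remainder_le (hasSubst_jet hF.2) (hsubst H hH) (hsubst H' hH')
    (fun v => (huρ v).trans (ht2 ▸ le_self_add)) (hsum H hH hHB) (hsum H' hH' hHB')
    (hvar H hH hHB) (hvar H' hH' hHB') hD f
  rw [h4t] at key
  rw [jet_add, jet_add]
  set N := jetNorm m q ρ (H - H')
  set X := subst (jet m F + jetVariation m H) f - subst (jet m F + jetVariation m H') f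
  set Y := ∑ v, subst (jet m F) (pderiv 𝕜 v f) * (jetVariation m H v - jetVariation m H' v)
    with hY
  have hrem : absNorm ρ (X - Y) ≤ ((t : ℝ≥0∞) ^ 2)⁻¹ * (B * absNorm t₀ f) * ρ * N := by
    rw [mul_assoc, mul_assoc]
    refine le_inv_mul_of_mul_le htne htnt ?_
    refine key.trans (le_of_eq ?_)
    calc _ = ((ρ : ℝ≥0∞) ^ q)⁻¹ * (ρ : ℝ≥0∞) ^ q * (B * absNorm t₀ f * (ρ * N)) := by ring
      _ = _ := by rw [ENNReal.inv_mul_cancel hρne hρnt, one_mul]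
  have hlin : absNorm ρ Y ≤ (∑ v, K v) * ρ * N := by
    rw [hY, Fintype.sum_sum_type, mul_assoc, Finset.sum_mul]
    have hz : ∀ i : Fin n, subst (jet m F) (pderiv 𝕜 (Sum.inl i : JetCoord n m) f) *
        (jetVariation m H (Sum.inl i) - jetVariation m H' (Sum.inl i)) = 0 := fun i => by
      simp [jetVariation]
    simp_rw [hz]
    rw [Finset.sum_const_zero, zero_add]
    refine (absNorm_sum_le _ _ _).trans (Finset.sum_le_sum fun v _ => ?_)
    rw [jetVariation_sub]
    refine (absNorm_mul_le _ _ _).trans ((mul_le_mul_left (hKρ v) _).trans ?_)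
    rw [mul_assoc]
    exact mul_le_mul_right (pow_mul_absNorm_partialDeriv_le_mul_jetNorm hρ0 hρ1
      ((FormalMaps 𝕜 n m 0).sub_mem hH hH') v) _
  calc absNorm ρ X = absNorm ρ (X - Y + Y) := by rw [sub_add_cancel]
    _ ≤ _ := absNorm_add_le _ _ _
    _ ≤ _ := add_le_add hrem hlin
    _ = _ := by ring

end Contraction

/-! ### Successive approximations -/

section Orders

variable {𝕜 : Type*} [RCLike 𝕜] {n r s : ℕ} {m : Fin r → ℕ} {q : ℕ}

theorem le_filteredOrder {F : Fin r → MvPowerSeries (Fin n) 𝕜} {k : ℕ}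
    (h : ∀ i, ((m i + k : ℕ) : ℕ∞) ≤ (F i).order) : (k : ℕ∞) ≤ filteredOrder m F := by
  refine le_iInf fun i => ?_
  have h1 := tsub_le_tsub_right (h i) (m i : ℕ∞)
  rwa [← ENat.natCast_sub, Nat.add_sub_cancel_left] at h1

theorem eq_of_forall_le_tupleOrder {F G : Fin s → MvPowerSeries (Fin n) 𝕜}
    (h : ∀ k : ℕ, (k : ℕ∞) ≤ tupleOrder (F - G)) : F = G := by
  funext i
  rw [← sub_eq_zero]
  ext α
  refine coeff_of_lt_order (lt_of_lt_of_le ?_ ((h (α.degree + 1)).trans (iInf_le _ i)))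
  exact_mod_cast Nat.lt_succ_self _

theorem le_tupleOrder_sub {F G : Fin s → MvPowerSeries (Fin n) 𝕜} {k : ℕ∞}
    (hF : k ≤ tupleOrder F) (hG : k ≤ tupleOrder G) : k ≤ tupleOrder (F - G) := by
  refine le_iInf fun i => ?_
  rw [Pi.sub_apply, sub_eq_add_neg]
  refine le_trans (le_min (hF.trans (iInf_le _ i)) ?_) min_order_le_add
  rw [order_neg]
  exact hG.trans (iInf_le _ i)

end Orders

/-! ### The iteration: orders, formal limit and uniform bounds -/

section Picard

variable {𝕜 : Type*} [RCLike 𝕜] {n r s : ℕ} {m : Fin r → ℕ} {q : ℕ}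
  (S : AnalyticMaps 𝕜 n m 0 →ₗ[𝕜] AnalyticGerms 𝕜 n s)
  (T : AnalyticMaps 𝕜 n m 0 → AnalyticGerms 𝕜 n s)
  (π : AnalyticGerms 𝕜 n s →ₗ[𝕜] LinearMap.range S)
  (R : LinearMap.range S → AnalyticMaps 𝕜 n m 0)

/-- Successive approximations of a solution of `S F = π (T F)`, for a right inverse `R` of `S`. -/
def picardIterate : ℕ → AnalyticMaps 𝕜 n m 0
  | 0 => 0
  | k + 1 => picardIterate k + R (π (T (picardIterate k)) - S.rangeRestrict (picardIterate k))

variable {S T π R}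

theorem map_picardIterate_succ (hR : ∀ y, S (R y) = y) (k : ℕ) :
    S.rangeRestrict (picardIterate S T π R (k + 1)) = π (T (picardIterate S T π R k)) := by
  apply Subtype.ext
  change S (picardIterate S T π R (k + 1)) = _
  rw [picardIterate, map_add, hR, Submodule.coe_sub]
  exact add_sub_cancel _ _

/-- Linearity of `π` alone puts the increment in the form `R (π G)`, to which the majorant estimate
applies; no additivity of `R` enters. -/
theorem picardIterate_succ_sub (hR : ∀ y, S (R y) = y) (k : ℕ) :
    picardIterate S T π R (k + 2) - picardIterate S T π R (k + 1) =
      R (π (T (picardIterate S T π R (k + 1)) - T (picardIterate S T π R k))) := by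
  rw [map_sub, ← map_picardIterate_succ hR k, picardIterate, add_sub_cancel_left]

theorem picardIterate_one_sub :
    picardIterate S T π R 1 - picardIterate S T π R 0 = R (π (T 0)) := by
  change 0 + R (π (T 0) - S.rangeRestrict 0) - 0 = _
  rw [map_zero, sub_zero, zero_add]
  exact congrArg R (Subtype.ext (sub_zero _))

/-- The right inverse loses at most `q` orders. -/
theorem le_order_rightInverse {C : ℝ}
    (hest : ∀ G : AnalyticGerms 𝕜 n s, ((q + 1 : ℕ) : ℕ∞) ≤ tupleOrder G.1 → ∀ i : Fin r,
      Dominated ((PowerSeries.derivative ℝ)^[m i]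
        (PowerSeries.X ^ q * hat (fun _ : Fin 1 => (R (π G)).1 i))) (C • hat G.1))
    {G : AnalyticGerms 𝕜 n s} {k : ℕ} (hG : ((k + 1 + q : ℕ) : ℕ∞) ≤ tupleOrder G.1)
    (i : Fin r) : ((m i + (k + 1) : ℕ) : ℕ∞) ≤ ((R (π G)).1 i).order :=
  le_order_of_dominated ((R (π G)).2.2 i)
    (hest G (le_trans (by exact_mod_cast (by omega : q + 1 ≤ k + 1 + q)) hG) i) hG

/-- Induction with net gain one: `R ∘ π` loses at most `q` orders and `T` gains `q + 1`. The
vanishing jet of `T 0` starts it. -/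
theorem le_order_picardIterate_sub {C : ℝ} (hT : StrictlyIncreasesOrder q T)
    (hT0 : ((q + 1 : ℕ) : ℕ∞) ≤ tupleOrder (T 0).1) (hR : ∀ y, S (R y) = y)
    (hest : ∀ G : AnalyticGerms 𝕜 n s, ((q + 1 : ℕ) : ℕ∞) ≤ tupleOrder G.1 → ∀ i : Fin r,
      Dominated ((PowerSeries.derivative ℝ)^[m i]
        (PowerSeries.X ^ q * hat (fun _ : Fin 1 => (R (π G)).1 i))) (C • hat G.1)) (k : ℕ) :
    ∃ G : AnalyticGerms 𝕜 n s,
      picardIterate S T π R (k + 1) - picardIterate S T π R k = R (π G) ∧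
      ((k + 1 + q : ℕ) : ℕ∞) ≤ tupleOrder G.1 := by
  induction k with
  | zero => exact ⟨T 0, picardIterate_one_sub, by rwa [zero_add, add_comm 1 q]⟩
  | succ k ih =>
    obtain ⟨G, hG, hGord⟩ := ih
    refine ⟨_, picardIterate_succ_sub hR k, ?_⟩
    refine le_trans ?_ (hT _ _)
    have h1 : ((k + 1 : ℕ) : ℕ∞) ≤ filteredOrder m
        (picardIterate S T π R (k + 1) - picardIterate S T π R k).1 := by
      rw [hG]
      exact le_filteredOrder (le_order_rightInverse hest hGord)
    calc ((k + 1 + 1 + q : ℕ) : ℕ∞) = ((k + 1 : ℕ) : ℕ∞) + q + 1 := by push_cast; ring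
      _ ≤ _ := by gcongr

theorem le_order_picardIterate_add_sub
    (hD : ∀ k i, ((m i + (k + 1) : ℕ) : ℕ∞) ≤
      ((picardIterate S T π R (k + 1) - picardIterate S T π R k).1 i).order) (k d : ℕ)
    (i : Fin r) : ((m i + (k + 1) : ℕ) : ℕ∞) ≤
      ((picardIterate S T π R (k + d)).1 i - (picardIterate S T π R k).1 i).order := by
  induction d with
  | zero => simp
  | succ d ih =>
    have e : (picardIterate S T π R (k + (d + 1))).1 i - (picardIterate S T π R k).1 i =
        (picardIterate S T π R (k + d + 1) - picardIterate S T π R (k + d)).1 i +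
        ((picardIterate S T π R (k + d)).1 i - (picardIterate S T π R k).1 i) := by
      simp [add_assoc]
    rw [e]
    refine le_trans (le_min (le_trans ?_ (hD (k + d) i)) ih) min_order_le_add
    exact_mod_cast (by omega : m i + (k + 1) ≤ m i + (k + d + 1))

variable (S T π R) in
/-- The formal limit of the successive approximations. -/
def picardLimit : Fin r → MvPowerSeries (Fin n) 𝕜 :=
  -- This coefficient is already stable at index `β.degree`; the shift by `q` selects iterates
  -- covered by the uniform bound, which begins at index `q`.
  fun i β => coeff β ((picardIterate S T π R (q + β.degree)).1 i)

theorem le_order_picardLimit_sub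
    (hD : ∀ k i, ((m i + (k + 1) : ℕ) : ℕ∞) ≤
      ((picardIterate S T π R (k + 1) - picardIterate S T π R k).1 i).order) (k : ℕ)
    (i : Fin r) : ((m i + (k + 1) : ℕ) : ℕ∞) ≤
      (picardLimit (q := q) S T π R i - (picardIterate S T π R k).1 i).order := by
  refine nat_le_order fun β hβ => ?_
  have e : coeff β (picardLimit (q := q) S T π R i) =
      coeff β ((picardIterate S T π R (q + β.degree)).1 i) := rfl
  rw [map_sub, e, ← map_sub]
  rcases le_total k (q + β.degree) with h | h
  · obtain ⟨d, hd⟩ := Nat.exists_eq_add_of_le h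
    rw [hd]
    exact coeff_of_lt_order (lt_of_lt_of_le (by exact_mod_cast hβ)
      (le_order_picardIterate_add_sub hD k d i))
  · obtain ⟨d, hd⟩ := Nat.exists_eq_add_of_le h
    rw [hd, ← neg_sub, map_neg, neg_eq_zero]
    refine coeff_of_lt_order (lt_of_lt_of_le ?_
      (le_order_picardIterate_add_sub hD (q + β.degree) d i))
    exact_mod_cast (by omega : β.degree < m i + (q + β.degree + 1))

theorem picardLimit_mem_formalMaps
    (hD : ∀ k i, ((m i + (k + 1) : ℕ) : ℕ∞) ≤
      ((picardIterate S T π R (k + 1) - picardIterate S T π R k).1 i).order) :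
    picardLimit (q := q) S T π R ∈ FormalMaps 𝕜 n m 0 := by
  intro i
  have h := le_order_picardLimit_sub (q := q) hD 0 i
  simpa [picardIterate] using h

/-- The limit of the successive approximations solves the equation, if it converges. -/
theorem map_eq_of_le_order_sub {C : ℝ} (hT : StrictlyIncreasesOrder q T)
    (hS : IncreasesOrder q S) (hR : ∀ y, S (R y) = y)
    (hest : ∀ G : AnalyticGerms 𝕜 n s, ((q + 1 : ℕ) : ℕ∞) ≤ tupleOrder G.1 → ∀ i : Fin r,
      Dominated ((PowerSeries.derivative ℝ)^[m i]
        (PowerSeries.X ^ q * hat (fun _ : Fin 1 => (R (π G)).1 i))) (C • hat G.1))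
    {L : AnalyticMaps 𝕜 n m 0} (hL : ∀ k i, ((m i + (k + 1) : ℕ) : ℕ∞) ≤
      (L.1 i - (picardIterate S T π R k).1 i).order) : S L = π (T L) := by
  refine Subtype.ext (eq_of_forall_le_tupleOrder fun k => ?_)
  have h1 : (k : ℕ∞) ≤ tupleOrder (S L - S (picardIterate S T π R (k + 1))).1 := by
    have h2 : ((k + 1 + 1 : ℕ) : ℕ∞) ≤ filteredOrder m
        (L - picardIterate S T π R (k + 1)).1 := le_filteredOrder (hL (k + 1))
    refine le_trans ?_ ((add_le_add_left h2 (q : ℕ∞)).trans (hS _ _))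
    exact_mod_cast (by omega : k ≤ k + 1 + 1 + q)
  have h3 : ((k + 1 + 1 + q : ℕ) : ℕ∞) ≤ tupleOrder (T L - T (picardIterate S T π R k)).1 := by
    have h4 : ((k + 1 : ℕ) : ℕ∞) ≤ filteredOrder m (L - picardIterate S T π R k).1 :=
      le_filteredOrder (hL k)
    refine le_trans ?_ (hT _ _)
    calc ((k + 1 + 1 + q : ℕ) : ℕ∞) = ((k + 1 : ℕ) : ℕ∞) + q + 1 := by push_cast; ring
      _ ≤ _ := by gcongr
  have h5 : (k : ℕ∞) ≤
      tupleOrder (π (T L - T (picardIterate S T π R k)) : AnalyticGerms 𝕜 n s).1 := by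
    -- The effect of `π` on orders is not given directly; it follows by writing `π G = S (R (π G))`,
    -- where `R ∘ π` loses at most `q` orders and `S` regains them.
    have h6 : ((k + 1 + 1 : ℕ) : ℕ∞) ≤
        filteredOrder m (R (π (T L - T (picardIterate S T π R k))) - 0).1 := by
      rw [sub_zero]
      exact le_filteredOrder (le_order_rightInverse hest h3)
    have h7 := (add_le_add_left h6 (q : ℕ∞)).trans (hS _ _)
    rw [hR, map_zero, sub_zero] at h7
    refine le_trans ?_ h7
    exact_mod_cast (by omega : k ≤ k + 1 + 1 + q)
  have h8 : (S (picardIterate S T π R (k + 1)) : AnalyticGerms 𝕜 n s) =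
      π (T (picardIterate S T π R k)) := by
    rw [← map_picardIterate_succ hR k]
    rfl
  have h9 := le_tupleOrder_sub h1 h5
  rw [h8, map_sub] at h9
  simpa using h9

/-- The successive approximations are bounded on a small polydisc. -/
theorem exists_absNorm_picardIterate_le {C : ℝ} (hC : 0 ≤ C)
    {W : Fin s → MvPowerSeries (JetCoord n m) 𝕜} (hW : IsDifferentialMap W T)
    (hreg : IsRegular q W) (hT : StrictlyIncreasesOrder q T) (hR : ∀ y, S (R y) = y)
    (hest : ∀ G : AnalyticGerms 𝕜 n s, ((q + 1 : ℕ) : ℕ∞) ≤ tupleOrder G.1 → ∀ i : Fin r,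
      Dominated ((PowerSeries.derivative ℝ)^[m i]
        (PowerSeries.X ^ q * hat (fun _ : Fin 1 => (R (π G)).1 i))) (C • hat G.1))
    (hD : ∀ k, ∃ G : AnalyticGerms 𝕜 n s,
      picardIterate S T π R (k + 1) - picardIterate S T π R k = R (π G) ∧
      ((k + 1 + q : ℕ) : ℕ∞) ≤ tupleOrder G.1) :
    ∃ ρ : ℝ≥0, 0 < ρ ∧ ∀ i, ∃ M : ℝ≥0∞, M ≠ ∞ ∧
      ∀ k, absNorm ρ ((picardIterate S T π R (q + k)).1 i) ≤ M := by
  set P := picardIterate S T π R with hP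
  set A : ℝ≥0∞ := r * ENNReal.ofReal C with hA
  have hAtop : A ≠ ∞ := ENNReal.mul_ne_top (ENNReal.natCast_ne_top r) ENNReal.ofReal_ne_top
  have hAnorm : ∀ (ρ : ℝ≥0) (G : AnalyticGerms 𝕜 n s), ((q + 1 : ℕ) : ℕ∞) ≤ tupleOrder G.1 →
      jetNorm m q ρ (R (π G)).1 ≤ A * ∑ j, absNorm ρ (G.1 j) := fun ρ G hG =>
    jetNorm_le_of_dominated ρ hC (R (π G)).2.2 (hest G hG)
  obtain ⟨B, hB, hBe⟩ : ∃ B : ℝ≥0∞, B ≠ ∞ ∧ ∀ᶠ ρ : ℝ≥0 in 𝓝[>] (0 : ℝ≥0),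
      jetNorm m q ρ (P (q + 1) - P q).1 ≤ B * (ρ : ℝ≥0∞) ^ (2 * q + 1) := by
    obtain ⟨G, hG, hGord⟩ := hD q
    have hGord' : ((q + 1 : ℕ) : ℕ∞) ≤ tupleOrder G.1 :=
      le_trans (by exact_mod_cast (by omega : q + 1 ≤ q + 1 + q)) hGord
    obtain ⟨ρ₀, hfin, hρ₀⟩ := ((eventually_all.2 fun j : Fin s =>
      (G.2 j).eventually_absNorm_ne_top).and self_mem_nhdsWithin).exists
    have hne : (ρ₀ : ℝ≥0∞) ^ (q + 1 + q) ≠ 0 := pow_ne_zero _ (by exact_mod_cast (ne_of_gt hρ₀))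
    refine ⟨((ρ₀ : ℝ≥0∞) ^ (q + 1 + q))⁻¹ * (A * ∑ j, absNorm ρ₀ (G.1 j)),
      ENNReal.mul_ne_top (ENNReal.inv_ne_top.2 hne)
        (ENNReal.mul_ne_top hAtop (ENNReal.sum_ne_top.2 fun j _ => hfin j)), ?_⟩
    filter_upwards [eventually_radius_le hρ₀] with ρ hρ
    rw [hG, mul_assoc]
    refine le_inv_mul_of_mul_le hne (ENNReal.pow_ne_top ENNReal.coe_ne_top) ?_
    rw [mul_comm, mul_comm (A * _), (by ring : 2 * q + 1 = q + 1 + q)]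
    exact (jetNorm_mul_pow_le hρ (le_order_rightInverse hest hGord)).trans
      (mul_le_mul_right (hAnorm _ _ hGord') _)
  -- Increments that halve, starting from `b`, stay within distance `2 * b` of `P q`, so the
  -- contraction is taken on the ball with constant `2 * B`.
  have hcontr : ∀ j : Fin s, _ := fun j => exists_absNorm_subst_jet_sub_le (q := q)
    (hW.convergent j) (P q).2 (hreg _ (P q).2.2 j) (ENNReal.mul_ne_top ENNReal.ofNat_ne_top hB :
      2 * B ≠ ∞)
  choose c hc hce using hcontr
  have hctop : A * ∑ j, c j ≠ ∞ :=
    ENNReal.mul_ne_top hAtop (ENNReal.sum_ne_top.2 fun j _ => hc j)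
  obtain ⟨ρ, hBρ, hcρ, hhalf, hfin, hρ0⟩ := (hBe.and ((eventually_all.2 hce).and
    ((eventually_mul_pow_le hctop (by simp : (0 : ℝ≥0∞) < 2⁻¹) 0).and
    ((eventually_all.2 fun i : Fin r => ((P q).2.1 i).eventually_absNorm_ne_top).and
    self_mem_nhdsWithin)))).exists
  rw [zero_add, pow_one] at hhalf
  have hρne : (ρ : ℝ≥0∞) ^ q ≠ 0 := pow_ne_zero _ (by exact_mod_cast (ne_of_gt hρ0))
  have hρnt : (ρ : ℝ≥0∞) ^ q ≠ ∞ := ENNReal.pow_ne_top ENNReal.coe_ne_top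
  set b := jetNorm m q ρ (P (q + 1) - P q).1 with hb
  have hbtop : b ≠ ∞ := ne_top_of_le_ne_top
    (ENNReal.mul_ne_top hB (ENNReal.pow_ne_top ENNReal.coe_ne_top)) hBρ
  have hball : ∀ k, jetNorm m q ρ (P (q + k) - P q).1 ≤ 2 * b →
      jetNorm m q ρ (P (q + k) - P q).1 ≤ 2 * B * (ρ : ℝ≥0∞) ^ (2 * q + 1) := by
    intro k hk
    refine hk.trans ?_
    rw [mul_assoc]
    exact mul_le_mul_right hBρ _
  -- The second invariant adds the remaining geometric tail to the distance already travelled; it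
  -- keeps the iterates in the ball where the contraction is valid without subtracting in `ℝ≥0∞`.
  have hmain : ∀ k, jetNorm m q ρ (P (q + k + 1) - P (q + k)).1 ≤ 2⁻¹ ^ k * b ∧
      jetNorm m q ρ (P (q + k) - P q).1 + 2 * (2⁻¹ ^ k * b) ≤ 2 * b := by
    intro k
    induction k with
    | zero => simp [hb]
    | succ k ih =>
      obtain ⟨ih1, ih2⟩ := ih
      have hhalf2 : (2 : ℝ≥0∞) * (2⁻¹ ^ (k + 1) * b) = 2⁻¹ ^ k * b := by
        rw [pow_succ', mul_assoc, ← mul_assoc,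
          ENNReal.mul_inv_cancel two_ne_zero ENNReal.ofNat_ne_top, one_mul]
      have hstep : jetNorm m q ρ (P (q + (k + 1)) - P q).1 + 2 * (2⁻¹ ^ (k + 1) * b) ≤
          2 * b := by
        have e : (P (q + (k + 1)) - P q).1 =
            (P (q + k) - P q).1 + (P (q + k + 1) - P (q + k)).1 := by
          rw [← Submodule.coe_add]
          congr 1
          rw [← add_assoc]
          abel
        rw [e, hhalf2]
        calc _ ≤ jetNorm m q ρ (P (q + k) - P q).1 + 2⁻¹ ^ k * b + 2⁻¹ ^ k * b := by
              gcongr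
              exact (jetNorm_add_le _ _ _).trans (by gcongr)
          _ = jetNorm m q ρ (P (q + k) - P q).1 + 2 * (2⁻¹ ^ k * b) := by ring
          _ ≤ _ := ih2
      refine ⟨?_, hstep⟩
      have hord : ((q + 1 : ℕ) : ℕ∞) ≤ tupleOrder (T (P (q + k + 1)) - T (P (q + k))).1 :=
        le_trans (by rw [Nat.cast_succ, add_assoc]; exact le_add_self) (hT _ _)
      have e1 : P (q + (k + 1) + 1) - P (q + (k + 1)) =
          R (π (T (P (q + k + 1)) - T (P (q + k)))) := picardIterate_succ_sub hR (q + k)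
      rw [e1]
      have hTdiff : ∀ j, absNorm ρ ((T (P (q + k + 1)) - T (P (q + k))).1 j) ≤
          c j * ρ * jetNorm m q ρ (P (q + k + 1) - P (q + k)).1 := by
        intro j
        have h1 := hcρ j _ (P (q + (k + 1)) - P q).2.2 _ (P (q + k) - P q).2.2
          (hball _ (le_self_add.trans hstep)) (hball _ (le_self_add.trans ih2))
        have e2 : ∀ F : AnalyticMaps 𝕜 n m 0, (P q).1 + (F - P q).1 = F.1 := fun F => by simp
        have e3 : (P (q + (k + 1)) - P q).1 - (P (q + k) - P q).1 =
            (P (q + k + 1) - P (q + k)).1 := by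
          rw [← Submodule.coe_sub, sub_sub_sub_cancel_right, add_assoc]
        rw [e2, e2, e3, ← hW.eq_subst, ← hW.eq_subst] at h1
        exact h1
      calc _ ≤ A * ∑ j, absNorm ρ ((T (P (q + k + 1)) - T (P (q + k))).1 j) := hAnorm _ _ hord
        _ ≤ A * ∑ j, c j * ρ * jetNorm m q ρ (P (q + k + 1) - P (q + k)).1 := by
          gcongr with j
          exact hTdiff j
        _ = (A * ∑ j, c j) * ρ * jetNorm m q ρ (P (q + k + 1) - P (q + k)).1 := by
          rw [← Finset.sum_mul, ← Finset.sum_mul]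
          ring
        _ ≤ 2⁻¹ * (2⁻¹ ^ k * b) := mul_le_mul' hhalf ih1
        _ = _ := by rw [pow_succ', mul_assoc]
  refine ⟨ρ, hρ0, fun i => ⟨absNorm ρ ((P q).1 i) + ((ρ : ℝ≥0∞) ^ q)⁻¹ *
    ((ρ : ℝ≥0∞) ^ m i * (2 * b)), ENNReal.add_ne_top.2 ⟨hfin i, ENNReal.mul_ne_top
      (ENNReal.inv_ne_top.2 hρne) (ENNReal.mul_ne_top (ENNReal.pow_ne_top ENNReal.coe_ne_top)
      (ENNReal.mul_ne_top ENNReal.ofNat_ne_top hbtop))⟩, fun k => ?_⟩⟩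
  have e : (P (q + k)).1 i = (P q).1 i + (P (q + k) - P q).1 i := by simp
  rw [e]
  refine (absNorm_add_le _ _ _).trans (add_le_add le_rfl (le_inv_mul_of_mul_le hρne hρnt ?_))
  -- The derivative of order zero turns the jet norm bound into a bound on the series itself.
  have h0 : partialDeriv 0 ((P (q + k) - P q).1 i) = (P (q + k) - P q).1 i := by
    ext β
    simp [coeff_partialDeriv]
  have h1 := pow_mul_absNorm_partialDeriv_le (q := q) ρ (P (q + k) - P q).2.2 i
    (α := 0) (by simp)
  rw [h0, map_zero, Nat.sub_zero] at h1
  exact h1.trans (mul_le_mul_right (le_self_add.trans (hmain k).2) _)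

end Picard

end BigDenom

end

/-! ### The main theorem -/

theorem theorem3p2 {𝕜 : Type*} [RCLike 𝕜] {n r s : ℕ} (m : Fin r → ℕ)
    (S : BigDenom.AnalyticMaps 𝕜 n m 0 →ₗ[𝕜] BigDenom.AnalyticGerms 𝕜 n s)
    (T : BigDenom.AnalyticMaps 𝕜 n m 0 → BigDenom.AnalyticGerms 𝕜 n s)
    (π : BigDenom.AnalyticGerms 𝕜 n s →ₗ[𝕜] LinearMap.range S)
    (h : BigDenom.HasBigDenominators S T π) :
    ∃ F : BigDenom.AnalyticMaps 𝕜 n m 0, S F = π (T F) := by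
  obtain ⟨q, ⟨W, hW, hreg⟩, hT, hT0, hS, -, R, hR, C, hC, hest⟩ := h
  have hD := BigDenom.le_order_picardIterate_sub hT hT0 hR hest
  have hord : ∀ k i, ((m i + (k + 1) : ℕ) : ℕ∞) ≤
      ((BigDenom.picardIterate S T π R (k + 1) - BigDenom.picardIterate S T π R k).1 i).order := by
    intro k
    obtain ⟨G, hG, hGord⟩ := hD k
    rw [hG]
    exact BigDenom.le_order_rightInverse hest hGord
  obtain ⟨ρ, hρ, hM⟩ := BigDenom.exists_absNorm_picardIterate_le hC.le hW hreg hT hR hest hD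
  refine ⟨⟨BigDenom.picardLimit (q := q) S T π R, fun i => ?_,
    BigDenom.picardLimit_mem_formalMaps hord⟩,
    BigDenom.map_eq_of_le_order_sub hT hS hR hest (BigDenom.le_order_picardLimit_sub hord)⟩
  obtain ⟨M, hMtop, hMle⟩ := hM i
  -- Each coefficient of the limit is a coefficient of some iterate, and the bound `M` is the same
  -- for all of them.
  exact BigDenom.isConvergent_of_coeff_mul_pow_le hρ hMtop fun β =>
    (BigDenom.coeff_le_absNorm ρ ((BigDenom.picardIterate S T π R (q + β.degree)).1 i) β).trans
      (hMle β.degree)
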